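/- Let $K$ be a field of characteristic zero, $V$ a $K$-vector space, $f:V\to V$ a linear endomorphism, and $T(V)$ the tensor algebra with empty word $\emptyset$, concatenation product, and shuffle product ш (with $\emptyset$ ш $u=u=u$ ш $\emptyset$ and $xu$ ш $yv=x(u$ ш $yv)+y(xu$ ш $v)$ for $x,y\in V$). Let $\bullet$ be the bilinear product on $T(V)$ defined by $\emptyset\bullet w'=0$ and $xw\bullet w'=x(w\bullet w')+f(x)(w$ ш $w')$ for $x\in V$, $w,w'\in T(V)$. It is a right pre-Lie product; $T(V)$ with this product, and with the Lie bracket $[a,b]=a\bullet b-b\bullet a$, is denoted by $T(V,f)$. Let $S=S(T(V,f))$ be the symmetric algebra, with product $\times$, unit $1$, and the coproduct $\Delta(z)=z^{(1)}\otimes z^{(2)}$ for which $\times$ is compatible and the elements of $T(V,f)$ are primitive; $T(V,f)$ is identified with its image in $S$. There is exactly one bilinear extension $\bullet:S\otimes S\to S$ of the pre-Lie product such that, for $X,Y,Z\in S$ and $u,v\in T(V,f)$: $X\bullet 1=X$; $u\bullet(X\times v)=(u\bullet X)\bullet v-u\bullet(X\bullet v)$; $(X\times Y)\bullet Z=(X\bullet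 Z^{(1)})\times(Y\bullet Z^{(2)})$. It satisfies $T(V,f)\bullet S\subseteq T(V,f)$. The product $X\star Y=(X\bullet Y^{(1)})\times Y^{(2)}$ is associative with unit $1$, and there is an isomorphism of algebras from the enveloping algebra of the Lie algebra $T(V,f)$ to $(S,\star)$ that is the identity on $T(V,f)$. Let $w_1,\dots,w_k\in T(V,f)$, $k\ge 0$. For $I=\{i_1<\dots<i_p\}\subseteq\{1,\dots,k\}$ put $w_I=w_{i_1}\times\dots\times w_{i_p}$ and $w_I^{ш}=w_{i_1}$ ш $\cdots$ ш $w_{i_p}$ (with $w_\emptyset=1$ and $w_\emptyset^{ш}=\emptyset$), and let $\overline I$ be the complement of $I$. Below, $\sqcup$ denotes a disjoint union of possibly empty sets, and the sums run over all ordered families of such sets. For all $x\in V$ and $w\in T(V,f)$: 1. If $k\ge1$, then $\emptyset\bullet(w_1\times\dots\times w_k)=0$. 2. $xw\bullet(w_1\times\dots\times w_k)=\sum_{I\subseteq\{1,\dots,k\}}f^{k-|I|}(x)\big((w\bullet w_I)$ ш $w_{\overline I}^{ш}\big)$. 3. $\emptyset\star(w_1\times\dots\times w_k)=\emptyset\times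 w_1\times\dots\times w_k$. 4. $xw\star(w_1\times\dots\times w_k)=\sum_{I\sqcup J\sqcup L=\{1,\dots,k\}}\Big(f^{|J|}(x)\big((w\bullet w_I)$ ш $w_J^{ш}\big)\Big)\times w_L$. For $i\ge1$, $x_1,\dots,x_i\in V$ and pairwise disjoint sets $I_1,\dots,I_i\subseteq\{1,\dots,k\}$, put $N_{i+1}=\emptyset$, $N_j=f^{|I_j|}(x_j)\big(N_{j+1}$ ш $w_{I_j}^{ш}\big)$ for $j=i,\dots,1$, and $N(I_1,\dots,I_i)=N_1$, that is, $$N(I_1,\dots,I_i)=f^{|I_1|}(x_1)\Big(f^{|I_2|}(x_2)\big(\cdots\big(f^{|I_i|}(x_i)\,w_{I_i}^{ш}\big)\,ш\,w_{I_{i-1}}^{ш}\cdots\big)\,ш\,w_{I_1}^{ш}\Big).$$ Then: 5. $x_1\cdots x_i\bullet(w_1\times\dots\times w_k)=\sum_{I_1\sqcup\dots\sqcup I_i=\{1,\dots,k\}}N(I_1,\dots,I_i)$. 6. $x_1\cdots x_i\star(w_1\times\dots\times w_k)=\sum_{I_1\sqcup\dots\sqcup I_{i+1}=\{1,\dots,k\}}N(I_1,\dots,I_i)\times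 w_{I_{i+1}}$. -/

import Mathlib

open scoped TensorProduct

noncomputable section

namespace ComPreLie

universe u v w

variable {K : Type u} [CommRing K] {V : Type v} [AddCommGroup V] [Module K V]

/-! ### Linear maps out of `T(V)` defined by recursion on the length of words -/

section Recursion

variable {M : Type w} [AddCommGroup M] [Module K M]

/-- One step of the recursion `F (x u) = φ x u (F u)`, on pairs `(u, F u)`. -/
def wordRecStep (φ : V →ₗ[K] TensorAlgebra K V × M →ₗ[K] M) :
    V →ₗ[K] Module.End K (TensorAlgebra K V × M) where
  toFun x := LinearMap.prod
    (LinearMap.mulLeft K (TensorAlgebra.ι K x) ∘ₗ LinearMap.fst K _ _) (φ x)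
  map_add' x y := by ext <;> simp [add_mul]
  map_smul' c x := by ext <;> simp

/-- The linear map `F : T(V) → M` with `F ∅ = m₀` and `F (x u) = φ x (u, F u)`
for `x ∈ V`, `u ∈ T(V)`. -/
def wordRec (m₀ : M) (φ : V →ₗ[K] TensorAlgebra K V × M →ₗ[K] M) :
    TensorAlgebra K V →ₗ[K] M :=
  LinearMap.snd K (TensorAlgebra K V) M ∘ₗ
    LinearMap.applyₗ ((1 : TensorAlgebra K V), m₀) ∘ₗ
      (TensorAlgebra.lift K (wordRecStep φ)).toLinearMap

/-- To prove a linear property of all of `T(V)` it is enough to treat words, letter by letter. -/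
theorem word_induction {P : TensorAlgebra K V → Prop} (u : TensorAlgebra K V)
    (one : P 1) (cons : ∀ (x : V) (u : TensorAlgebra K V), P u → P (TensorAlgebra.ι K x * u))
    (add : ∀ a b, P a → P b → P (a + b)) (smul : ∀ (c : K) (a), P a → P (c • a)) : P u := by
  suffices h : ∀ b, P b → P (u * b) by simpa using h 1 one
  induction u using TensorAlgebra.induction with
  | algebraMap r => intro b hb; rw [← Algebra.smul_def]; exact smul r b hb
  | ι x => intro b hb; exact cons x b hb
  | mul a b iha ihb => intro c hc; rw [mul_assoc]; exact iha _ (ihb _ hc)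
  | add a b iha ihb => intro c hc; rw [add_mul]; exact add _ _ (iha _ hc) (ihb _ hc)

theorem wordRec_one (m₀ : M) (φ : V →ₗ[K] TensorAlgebra K V × M →ₗ[K] M) :
    wordRec m₀ φ 1 = m₀ := by
  simp [wordRec]

theorem wordRec_cons (m₀ : M) (φ : V →ₗ[K] TensorAlgebra K V × M →ₗ[K] M) (x : V)
    (u : TensorAlgebra K V) :
    wordRec m₀ φ (TensorAlgebra.ι K x * u) = φ x (u, wordRec m₀ φ u) := by
  have key : ∀ u : TensorAlgebra K V,
      (TensorAlgebra.lift K (wordRecStep φ) u ((1 : TensorAlgebra K V), m₀)).1 = u := by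
    intro u
    induction u using word_induction with
    | one => simp
    | cons x u ih =>
      rw [map_mul, TensorAlgebra.lift_ι_apply, Module.End.mul_apply]
      exact congrArg (TensorAlgebra.ι K x * ·) ih
    | add a b ha hb => simp [ha, hb]
    | smul c a ha => simp [ha]
  have h2 : TensorAlgebra.lift K (wordRecStep φ) u ((1 : TensorAlgebra K V), m₀)
      = (u, wordRec m₀ φ u) := Prod.ext (key u) rfl
  simp only [wordRec, LinearMap.comp_apply, AlgHom.toLinearMap_apply, map_mul,
    TensorAlgebra.lift_ι_apply, LinearMap.applyₗ_apply_apply, Module.End.mul_apply,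
    LinearMap.snd_apply]
  rw [h2]
  rfl

end Recursion

/-! ### The shuffle product and the pre-Lie product -/

/-- Deconcatenation `T(V) → T(V) ⊗ T(V)`, sending `x₁…xₙ` to the sum of the
`x₁…xᵢ ⊗ xᵢ₊₁…xₙ`, `0 ≤ i ≤ n`. -/
def deconc : TensorAlgebra K V →ₗ[K] TensorAlgebra K V ⊗[K] TensorAlgebra K V :=
  wordRec (1 ⊗ₜ[K] 1)
    { toFun := fun x => LinearMap.coprod
        (TensorProduct.mk K _ _ 1 ∘ₗ LinearMap.mulLeft K (TensorAlgebra.ι K x))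
        (LinearMap.rTensor _ (LinearMap.mulLeft K (TensorAlgebra.ι K x)))
      map_add' := fun x y => by
        ext <;> simp [add_mul, TensorProduct.tmul_add, TensorProduct.add_tmul]
      map_smul' := fun c x => by ext <;> simp [TensorProduct.smul_tmul'] }

theorem deconc_one : deconc (1 : TensorAlgebra K V) = 1 ⊗ₜ[K] 1 := wordRec_one _ _

theorem deconc_cons (x : V) (u : TensorAlgebra K V) :
    deconc (TensorAlgebra.ι K x * u) = 1 ⊗ₜ[K] (TensorAlgebra.ι K x * u) +
      LinearMap.rTensor _ (LinearMap.mulLeft K (TensorAlgebra.ι K x)) (deconc u) := by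
  rw [deconc, wordRec_cons]; rfl

/-- For an endomorphism `L` of `T(V)`, the map
`y₁…yₙ ↦ ∑_{0 ≤ i ≤ n} y₁…yᵢ x L(yᵢ₊₁…yₙ)`. -/
def insertLetter (x : V) (L : Module.End K (TensorAlgebra K V)) :
    Module.End K (TensorAlgebra K V) :=
  LinearMap.mul' K _ ∘ₗ
    LinearMap.lTensor _ (LinearMap.mulLeft K (TensorAlgebra.ι K x) ∘ₗ L) ∘ₗ deconc

theorem insertLetter_one (x : V) (L : Module.End K (TensorAlgebra K V)) :
    insertLetter x L 1 = TensorAlgebra.ι K x * L 1 := by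
  simp [insertLetter, deconc_one]

theorem insertLetter_cons (x : V) (L : Module.End K (TensorAlgebra K V)) (y : V)
    (v : TensorAlgebra K V) :
    insertLetter x L (TensorAlgebra.ι K y * v) =
      TensorAlgebra.ι K x * L (TensorAlgebra.ι K y * v) +
        TensorAlgebra.ι K y * insertLetter x L v := by
  simp only [insertLetter, LinearMap.comp_apply, deconc_cons, map_add, LinearMap.lTensor_tmul,
    LinearMap.mul'_apply, one_mul, LinearMap.mulLeft_apply]
  congr 1
  induction deconc v using TensorProduct.induction_on with
  | zero => simp
  | tmul a b => simp [mul_assoc]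
  | add a b ha hb => simp only [map_add, ha, hb, mul_add]

/-- The shuffle product of `T(V)`; it is characterised by `one_shuffle`, `shuffle_one` and
`cons_shuffle_cons` below. -/
def shuffle : TensorAlgebra K V →ₗ[K] TensorAlgebra K V →ₗ[K] TensorAlgebra K V :=
  wordRec (M := Module.End K (TensorAlgebra K V)) LinearMap.id
    { toFun := fun x =>
        { toFun := fun p => insertLetter x p.2
          map_add' := fun p q => by
            simp [insertLetter, LinearMap.comp_add, LinearMap.lTensor_add, LinearMap.add_comp]
          map_smul' := fun c p => by
            simp [insertLetter, LinearMap.comp_smul, LinearMap.lTensor_smul,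
              LinearMap.smul_comp] }
      map_add' := fun x y => by
        apply LinearMap.ext; intro p
        have h : LinearMap.mulLeft K (TensorAlgebra.ι K x + TensorAlgebra.ι K y)
          = LinearMap.mulLeft K (TensorAlgebra.ι K x) +
            LinearMap.mulLeft K (TensorAlgebra.ι K y) := by
          apply LinearMap.ext; intro; simp [add_mul]
        simp [insertLetter, h, LinearMap.comp_add, LinearMap.lTensor_add, LinearMap.add_comp]
      map_smul' := fun c x => by
        apply LinearMap.ext; intro p
        have h : LinearMap.mulLeft K (c • TensorAlgebra.ι K x)
          = c • LinearMap.mulLeft K (TensorAlgebra.ι K x) := by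
          apply LinearMap.ext; intro; simp
        simp [insertLetter, h, LinearMap.comp_smul, LinearMap.lTensor_smul,
          LinearMap.smul_comp] }

theorem one_shuffle (v : TensorAlgebra K V) : shuffle 1 v = v := by
  rw [shuffle, wordRec_one]; rfl

theorem cons_shuffle (x : V) (u : TensorAlgebra K V) :
    shuffle (TensorAlgebra.ι K x * u) = insertLetter x (shuffle u) := by
  conv_lhs => rw [shuffle, wordRec_cons]
  rfl

theorem cons_shuffle_cons (x y : V) (u v : TensorAlgebra K V) :
    shuffle (TensorAlgebra.ι K x * u) (TensorAlgebra.ι K y * v) =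
      TensorAlgebra.ι K x * shuffle u (TensorAlgebra.ι K y * v) +
        TensorAlgebra.ι K y * shuffle (TensorAlgebra.ι K x * u) v := by
  simp only [cons_shuffle, insertLetter_cons]

theorem shuffle_one (u : TensorAlgebra K V) : shuffle u 1 = u := by
  induction u using word_induction with
  | one => exact one_shuffle 1
  | cons x u ih => rw [cons_shuffle, insertLetter_one, ih]
  | add a b ha hb => simp [ha, hb]
  | smul c a ha => simp [ha]

theorem shuffle_comm (a b : TensorAlgebra K V) : shuffle a b = shuffle b a := by
  induction a using word_induction generalizing b with
  | one => rw [one_shuffle, shuffle_one]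
  | cons x u ihu =>
    induction b using word_induction with
    | one => rw [one_shuffle, shuffle_one]
    | cons y v ihv =>
      rw [cons_shuffle_cons, cons_shuffle_cons, ihu, ihv, add_comm]
    | add a b ha hb => simp [ha, hb]
    | smul c a ha => simp [ha]
  | add a b ha hb => simp [ha, hb]
  | smul c a ha => simp [ha]

theorem shuffle_assoc (a b c : TensorAlgebra K V) :
    shuffle (shuffle a b) c = shuffle a (shuffle b c) := by
  induction a using word_induction generalizing b c with
  | one => simp only [one_shuffle]
  | cons x u ihu =>
    induction b using word_induction generalizing c with
    | one => simp only [one_shuffle, shuffle_one]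
    | cons y v ihv =>
      induction c using word_induction with
      | one => simp only [shuffle_one]
      | cons z t iht =>
        have h1 := ihu (TensorAlgebra.ι K y * v) (TensorAlgebra.ι K z * t)
        have h2 := ihv (TensorAlgebra.ι K z * t)
        rw [cons_shuffle_cons y z, map_add] at h1
        rw [cons_shuffle_cons x y, map_add, LinearMap.add_apply] at iht
        rw [cons_shuffle_cons x y u v, cons_shuffle_cons y z v t, map_add, LinearMap.add_apply,
          map_add, cons_shuffle_cons x z (shuffle u _) t, cons_shuffle_cons y z _ t,
          cons_shuffle_cons x y u (shuffle v _), cons_shuffle_cons x z u (shuffle _ t),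
          h2, ← iht, h1]
        simp only [mul_add]
        abel
      | add a b ha hb => simp [ha, hb]
      | smul c a ha => simp [ha]
    | add a b ha hb => simp [ha, hb]
    | smul c a ha => simp [ha]
  | add a b ha hb => simp [ha, hb]
  | smul c a ha => simp [ha]

/-- The bilinear product `•` of `T(V)` attached to the endomorphism `f`; it is characterised by
`one_bullet` and `cons_bullet` below. -/
def bullet (f : V →ₗ[K] V) :
    TensorAlgebra K V →ₗ[K] TensorAlgebra K V →ₗ[K] TensorAlgebra K V :=
  wordRec (M := Module.End K (TensorAlgebra K V)) 0
    { toFun := fun x => LinearMap.coprod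
        (LinearMap.compRight K (LinearMap.mulLeft K (TensorAlgebra.ι K (f x))) ∘ₗ shuffle)
        (LinearMap.compRight K (LinearMap.mulLeft K (TensorAlgebra.ι K x)))
      map_add' := fun x y => by
        apply LinearMap.ext; intro p; apply LinearMap.ext; intro t
        simp [add_mul]; abel
      map_smul' := fun c x => by
        apply LinearMap.ext; intro p; apply LinearMap.ext; intro t
        simp }

theorem one_bullet (f : V →ₗ[K] V) (v : TensorAlgebra K V) : bullet f 1 v = 0 := by
  rw [bullet, wordRec_one]; rfl

theorem cons_bullet (f : V →ₗ[K] V) (x : V) (u v : TensorAlgebra K V) :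
    bullet f (TensorAlgebra.ι K x * u) v =
      TensorAlgebra.ι K x * bullet f u v + TensorAlgebra.ι K (f x) * shuffle u v := by
  rw [add_comm]
  conv_lhs => rw [bullet, wordRec_cons]
  rfl

theorem shuffle_bullet (f : V →ₗ[K] V) (a b c : TensorAlgebra K V) :
    bullet f (shuffle a b) c = shuffle (bullet f a c) b + shuffle a (bullet f b c) := by
  induction a using word_induction generalizing b with
  | one => simp [one_shuffle, one_bullet]
  | cons x u ihu =>
    induction b using word_induction with
    | one => simp [shuffle_one, one_bullet]
    | cons y v ihv =>
      rw [cons_shuffle_cons]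
      simp only [map_add, LinearMap.add_apply, cons_bullet, ihu, ihv, cons_shuffle_cons, mul_add]
      have h1 : shuffle (shuffle u c) (TensorAlgebra.ι K y * v)
          = shuffle (shuffle u (TensorAlgebra.ι K y * v)) c := by
        rw [shuffle_assoc, shuffle_comm c, shuffle_assoc]
      have h2 := shuffle_assoc (TensorAlgebra.ι K x * u) v c
      rw [h1, h2]
      abel
    | add a b ha hb => simp only [map_add, LinearMap.add_apply, ha, hb]; abel
    | smul c a ha => simp [ha]
  | add a b ha hb => simp only [map_add, LinearMap.add_apply, ha, hb]; abel
  | smul c a ha => simp [ha]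

theorem bullet_preLie (f : V →ₗ[K] V) (a b c : TensorAlgebra K V) :
    bullet f (bullet f a b) c - bullet f a (bullet f b c) =
      bullet f (bullet f a c) b - bullet f a (bullet f c b) := by
  induction a using word_induction with
  | one => simp [one_bullet]
  | cons x u ih =>
    simp only [cons_bullet, map_add, LinearMap.add_apply, shuffle_bullet, mul_add]
    have h := congrArg (TensorAlgebra.ι K x * ·) ih
    simp only [mul_sub] at h
    rw [shuffle_assoc, shuffle_assoc, shuffle_comm b c, shuffle_comm (bullet f u b) c,
      shuffle_comm (bullet f u c) b, shuffle_comm c (bullet f u b),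
      shuffle_comm b (bullet f u c)]
    rw [← sub_eq_zero] at h ⊢
    rw [← h]
    abel
  | add a b ha hb =>
    simp only [map_add, LinearMap.add_apply, add_sub_add_comm, ha, hb]
  | smul c a ha => simp only [map_smul, LinearMap.smul_apply, ← smul_sub, ha]

/-! ### The pre-Lie algebra `T(V, f)` -/

/-- The vector space `T(V)`, to be equipped with the pre-Lie product `•` attached to `f`. -/
def TVf (_f : V →ₗ[K] V) : Type (max u v) := TensorAlgebra K V

instance (f : V →ₗ[K] V) : AddCommGroup (TVf f) :=
  inferInstanceAs (AddCommGroup (TensorAlgebra K V))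

instance (f : V →ₗ[K] V) : Module K (TVf f) :=
  inferInstanceAs (Module K (TensorAlgebra K V))

/-- The identity map from `T(V)` to `T(V, f)`. -/
def toTVf (f : V →ₗ[K] V) : TensorAlgebra K V ≃ₗ[K] TVf f := LinearEquiv.refl K _

/-- The multiplication of `T(V, f)` is `•`. -/
instance (f : V →ₗ[K] V) : NonUnitalNonAssocRing (TVf f) where
  mul a b := toTVf f (bullet f ((toTVf f).symm a) ((toTVf f).symm b))
  left_distrib a b c := by
    change toTVf f _ = toTVf f _ + toTVf f _
    simp
  right_distrib a b c := by
    change toTVf f _ = toTVf f _ + toTVf f _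
    simp
  zero_mul a := by change toTVf f _ = 0; simp
  mul_zero a := by change toTVf f _ = 0; simp

theorem TVf_mul_def (f : V →ₗ[K] V) (a b : TVf f) :
    a * b = toTVf f (bullet f ((toTVf f).symm a) ((toTVf f).symm b)) := rfl

instance (f : V →ₗ[K] V) : RightPreLieRing (TVf f) where
  assoc_symm' a b c := by
    simp only [associator_apply, TVf_mul_def, LinearEquiv.symm_apply_apply, ← map_sub]
    rw [bullet_preLie]

instance (f : V →ₗ[K] V) : RightPreLieAlgebra K (TVf f) where
  smul_assoc c a b := by simp [TVf_mul_def]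
  smul_comm c a b := by simp [TVf_mul_def]

/-! ### The extension of `•` to `S(T(V, f))` and the product `⋆` -/

/-- The symmetric algebra `S(T(V, f))`; its product is written `×` in the literature. -/
abbrev STVf (f : V →ₗ[K] V) : Type (max u v) := SymmetricAlgebra K (TVf f)

/-- The inclusion `T(V) = T(V, f) → S(T(V, f))`. -/
def incl (f : V →ₗ[K] V) : TensorAlgebra K V →ₗ[K] STVf f :=
  SymmetricAlgebra.ι K (TVf f) ∘ₗ (toTVf f).toLinearMap

/-- `B` is an extension of the pre-Lie product of `T(V, f)` to a product on `S(T(V, f))` in the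
sense of Oudom and Guin. The coproduct is that of Mathlib's bialgebra `SymmetricAlgebra`, for
which the elements of `T(V, f)` are primitive. -/
structure IsOudomGuinExtension (f : V →ₗ[K] V) (B : STVf f →ₗ[K] STVf f →ₗ[K] STVf f) :
    Prop where
  /-- `B` extends `•`. -/
  extends_bullet : ∀ u v : TensorAlgebra K V, B (incl f u) (incl f v) = incl f (bullet f u v)
  /-- `X • 1 = X`. -/
  apply_one : ∀ X : STVf f, B X 1 = X
  /-- `u • (X × v) = (u • X) • v - u • (X • v)` for `u, v ∈ T(V, f)`. -/
  incl_mul : ∀ (u v : TensorAlgebra K V) (X : STVf f),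
    B (incl f u) (X * incl f v) =
      B (B (incl f u) X) (incl f v) - B (incl f u) (B X (incl f v))
  /-- `(X × Y) • Z = (X • Z⁽¹⁾) × (Y • Z⁽²⁾)`. -/
  mul_apply : ∀ X Y Z : STVf f,
    B (X * Y) Z = LinearMap.mul' K (STVf f)
      (TensorProduct.map (B X) (B Y) (Coalgebra.comul (R := K) Z))

/-- The product `X ⋆ Y = (X • Y⁽¹⁾) × Y⁽²⁾`, where `• = B`. -/
def star {f : V →ₗ[K] V} (B : STVf f →ₗ[K] STVf f →ₗ[K] STVf f) (X Y : STVf f) : STVf f :=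
  LinearMap.mul' K (STVf f)
    (TensorProduct.map (B X) LinearMap.id (Coalgebra.comul (R := K) Y))

/-! ### Notation for the formulas -/

/-- `w_I = w_{i₁} × … × w_{i_p}` for `I = {i₁ < … < i_p}`. -/
def timesProd (f : V →ₗ[K] V) {k : ℕ} (w : Fin k → TensorAlgebra K V) (I : Finset (Fin k)) :
    STVf f :=
  ∏ i ∈ I, incl f (w i)

/-- The iterated shuffle `w_{i₁} ⧢ … ⧢ w_{i_p}` for `I = {i₁ < … < i_p}`
(the empty word if `I` is empty). -/
def shuffleProd {k : ℕ} (w : Fin k → TensorAlgebra K V) (I : Finset (Fin k)) :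
    TensorAlgebra K V :=
  (((List.finRange k).filter (· ∈ I)).map w).foldr (fun a b => shuffle a b) 1

/-- The families `(I₁, …, I_n)` of pairwise disjoint, possibly empty, sets with union
`{1, …, k}`. -/
def orderedPartitions (n k : ℕ) : Finset (Fin n → Finset (Fin k)) :=
  Finset.univ.filter fun P =>
    (∀ a b, a ≠ b → Disjoint (P a) (P b)) ∧ Finset.univ.biUnion P = Finset.univ

/-- The nested element
`f^|I₁|(x₁) (f^|I₂|(x₂) (… (f^|I_i|(x_i) w_{I_i}^⧢) ⧢ w_{I_{i-1}}^⧢ …) ⧢ w_{I₁}^⧢)`, built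
from the inside, starting from the empty word. -/
def nested (f : V →ₗ[K] V) {k : ℕ} (w : Fin k → TensorAlgebra K V) :
    (i : ℕ) → (Fin i → V) → (Fin i → Finset (Fin k)) → TensorAlgebra K V
  | 0, _, _ => 1
  | i + 1, x, P =>
      TensorAlgebra.ι K ((f ^ (P 0).card) (x 0)) *
        shuffle (nested f w i (fun j => x j.succ) (fun j => P j.succ)) (shuffleProd w (P 0))

end ComPreLie

end

/-!
Let `L` be a right pre-Lie algebra. Write `X • v` for the derivation of `S(L)` extending the right
product by `v ∈ L`. The maps `X ↦ X • v` and `X ↦ X ⋆ v = X • v + X × v` are two right actions of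
the Lie algebra `L` on `S(L)`, and the second one gives a map `U(L) → S(L)`, `p ↦ 1 ⋆ p`. To invert
it, one recovers `×` inside `U(L)`: the derivation `p ↦ p • v` makes sense on `U(L)`, because
`u ↦ (v ↦ u * v)` is a cocycle, and the pre-Lie identity says exactly that the operators
`p ↦ p v - p • v` commute, so they make `U(L)` a module over `S(L)`. Hence `U(L) ≃ S(L)` over any
commutative ring, and every right action of `L` extends from `L` to `S(L)`; applied to the actions
of `L` on `S(L)` by `•` and by `⋆`, and on `L` itself, this gives `X • Y`, `X ⋆ Y` and `u • Y ∈ L`.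

The extension `Y ↦ m ◁ Y` is the only linear map with `1 ↦ m` which intertwines `⋆ v` with the
action of `v`. Both sides of each identity are compared in this way; the operators `⋆ v` are
coderivations, which takes care of the identities that involve the coproduct.

For `T(V, f)`, the elements `xw • (w₁ × ⋯ × w_k)` involve `fʲ(x)` for several `j`. The exponent `j`
is recorded by the variable of a polynomial ring over the shuffle algebra, on which
`• v` is a derivation again. Then `xw • -` is the convolution of `w • -` with the algebra morphism
`w₁ × ⋯ × w_k ↦ (w₁ ⧢ ⋯ ⧢ w_k) Xᵏ`, followed by the substitution `a Xʲ ↦ fʲ(x) a`, and the formulas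
follow by expanding the coproduct of `w₁ × ⋯ × w_k` over subsets.
-/

noncomputable section

namespace ComPreLie

open Coalgebra Polynomial SymmetricAlgebra

section SymmetricAlgebra

variable {K M N : Type*} [CommRing K] [AddCommGroup M] [Module K M] [AddCommGroup N] [Module K N]

theorem sym_induction {P : SymmetricAlgebra K M → Prop} (one : P 1)
    (mul_ι : ∀ X v, P X → P (X * ι K M v))
    (add : ∀ X Y, P X → P Y → P (X + Y)) (smul : ∀ (c : K) X, P X → P (c • X))
    (X : SymmetricAlgebra K M) : P X := by
  suffices h : ∀ Y, P Y → P (Y * X) by simpa using h 1 one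
  induction X using SymmetricAlgebra.induction with
  | algebraMap r => intro Y hY; rw [mul_comm, ← Algebra.smul_def]; exact smul r Y hY
  | ι x => intro Y hY; exact mul_ι Y x hY
  | mul a b iha ihb => intro Y hY; rw [← mul_assoc]; exact ihb _ (iha _ hY)
  | add a b iha ihb => intro Y hY; rw [mul_add]; exact add _ _ (iha _ hY) (ihb _ hY)

theorem sym_linearMap_ext {φ ψ : SymmetricAlgebra K M →ₗ[K] N}
    (h : ∀ (k : ℕ) (w : Fin k → M), φ (∏ i, ι K M (w i)) = ψ (∏ i, ι K M (w i))) : φ = ψ := by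
  have span_eq_top : ∀ X : SymmetricAlgebra K M, X ∈ Submodule.span K
      (Set.range fun w : (Σ k, Fin k → M) => ∏ i, ι K M (w.2 i)) := by
    intro X
    induction X using sym_induction with
    | one => exact Submodule.subset_span ⟨⟨0, Fin.elim0⟩, by simp⟩
    | mul_ι X v hX =>
      induction hX using Submodule.span_induction with
      | mem X hX =>
        obtain ⟨⟨k, w⟩, rfl⟩ := hX
        exact Submodule.subset_span ⟨⟨k + 1, Fin.snoc w v⟩, by simp [Fin.prod_univ_castSucc]⟩
      | zero => simp
      | add X Y _ _ hX hY => rw [add_mul]; exact add_mem hX hY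
      | smul c X _ hX => rw [smul_mul_assoc]; exact Submodule.smul_mem _ _ hX
    | add X Y hX hY => exact add_mem hX hY
    | smul c X hX => exact Submodule.smul_mem _ _ hX
  ext X
  refine LinearMap.eqOn_span ?_ (span_eq_top X)
  rintro _ ⟨⟨k, w⟩, rfl⟩
  exact h k w

theorem symDerivation_ext [Module (SymmetricAlgebra K M) N]
    {D₁ D₂ : Derivation K (SymmetricAlgebra K M) N}
    (h : ∀ m, D₁ (ι K M m) = D₂ (ι K M m)) : D₁ = D₂ := by
  ext a
  induction a using SymmetricAlgebra.induction with
  | algebraMap r => simp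
  | ι x => exact h x
  | mul a b ha hb => simp [ha, hb]
  | add a b ha hb => simp [ha, hb]

/-- The algebra morphism `X ↦ X + ε D(X)` to the dual numbers over `S(M)`, where `D` is the
derivation of `S(M)` extending `φ`. -/
def symDualNumberHom (φ : Module.End K M) :
    SymmetricAlgebra K M →ₐ[K] TrivSqZeroExt (SymmetricAlgebra K M) (SymmetricAlgebra K M) :=
  SymmetricAlgebra.lift
    ((TrivSqZeroExt.inlAlgHom K _ _).toLinearMap ∘ₗ ι K M +
      (TrivSqZeroExt.inrHom _ _).restrictScalars K ∘ₗ ι K M ∘ₗ φ)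

theorem fst_symDualNumberHom (φ : Module.End K M) (X : SymmetricAlgebra K M) :
    (symDualNumberHom φ X).fst = X := by
  induction X using SymmetricAlgebra.induction with
  | algebraMap r => rw [AlgHom.commutes]; rfl
  | ι x => simp [symDualNumberHom]
  | mul a b ha hb => simp [ha, hb]
  | add a b ha hb => simp [ha, hb]

/-- The derivation of the symmetric algebra extending an endomorphism of the module. -/
def symDerivation :
    Module.End K M →ₗ[K] Derivation K (SymmetricAlgebra K M) (SymmetricAlgebra K M) where
  toFun φ := Derivation.mk'
    ((TrivSqZeroExt.sndHom (SymmetricAlgebra K M) (SymmetricAlgebra K M)).restrictScalars K ∘ₗ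
      (symDualNumberHom φ).toLinearMap)
    (fun a b => by simp [fst_symDualNumberHom, mul_comm])
  map_add' φ ψ := symDerivation_ext fun m => by simp [symDualNumberHom]
  map_smul' c φ := symDerivation_ext fun m => by simp [symDualNumberHom]

@[simp]
theorem symDerivation_ι (φ : Module.End K M) (m : M) :
    symDerivation φ (ι K M m) = ι K M (φ m) := by
  simp [symDerivation, symDualNumberHom]

theorem symDerivation_mul_ι (φ : Module.End K M) (X : SymmetricAlgebra K M) (m : M) :
    symDerivation φ (X * ι K M m) = symDerivation φ X * ι K M m + X * ι K M (φ m) := by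
  rw [Derivation.leibniz, symDerivation_ι, smul_eq_mul, smul_eq_mul]
  ring

theorem symDerivation_lie (φ ψ : Module.End K M) :
    symDerivation ⁅φ, ψ⁆ = ⁅symDerivation φ, symDerivation ψ⁆ :=
  symDerivation_ext fun m => by
    simp [Derivation.commutator_apply, LieRing.of_associative_ring_bracket]

theorem symι_injective : Function.Injective (ι K M) := by
  let _ : Module Kᵐᵒᵖ M := Module.compHom _ ((RingHom.id K).fromOpposite mul_comm)
  have _ : IsCentralScalar K M := ⟨fun r m => rfl⟩
  let F : SymmetricAlgebra K M →ₐ[K] TrivSqZeroExt K M :=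
    SymmetricAlgebra.lift (TrivSqZeroExt.inrHom K M)
  intro x y h
  simpa [F] using congrArg (fun a => (F a).snd) h

theorem isMulCommutative_adjoin_range {r : M →ₗ[K] Module.End K N}
    (hr : ∀ u v, Commute (r u) (r v)) : IsMulCommutative (Algebra.adjoin K (Set.range r)) :=
  Algebra.isMulCommutative_adjoin K (by rintro _ ⟨u, rfl⟩ _ ⟨v, rfl⟩; exact hr u v)

open scoped IsMulCommutative in
/-- The action of `S(M)` on `N` for which the elements of `M` act through the commuting operators
`r m`. -/
def symAction (r : M →ₗ[K] Module.End K N) (hr : ∀ u v, Commute (r u) (r v)) :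
    SymmetricAlgebra K M →ₐ[K] Module.End K N :=
  have := isMulCommutative_adjoin_range hr
  let A := Algebra.adjoin K (Set.range r)
  A.val.comp (SymmetricAlgebra.lift
    (r.codRestrict (Subalgebra.toSubmodule A) fun v => Algebra.subset_adjoin ⟨v, rfl⟩))

open scoped IsMulCommutative in
theorem symAction_ι (r : M →ₗ[K] Module.End K N) (hr : ∀ u v, Commute (r u) (r v)) (v : M) :
    symAction r hr (ι K M v) = r v :=
  have := isMulCommutative_adjoin_range hr
  congrArg Subtype.val (SymmetricAlgebra.lift_ι_apply
    (A := Algebra.adjoin K (Set.range r)) _ v)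

end SymmetricAlgebra

section EnvelopingAlgebra

variable {K L M : Type*} [CommRing K] [LieRing L] [LieAlgebra K L] [AddCommGroup M] [Module K M]

theorem enveloping_induction {P : UniversalEnvelopingAlgebra K L → Prop}
    (one : P 1) (mul_ι : ∀ p u, P p → P (p * UniversalEnvelopingAlgebra.ι K u))
    (add : ∀ a b, P a → P b → P (a + b)) (smul : ∀ (c : K) (a), P a → P (c • a))
    (p : UniversalEnvelopingAlgebra K L) : P p := by
  obtain ⟨a, rfl⟩ : ∃ a, UniversalEnvelopingAlgebra.mkAlgHom K L a = p :=
    Quotient.mk_surjective p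
  suffices h : ∀ b, P b → P (b * UniversalEnvelopingAlgebra.mkAlgHom K L a) by
    simpa using h 1 one
  induction a using TensorAlgebra.induction with
  | algebraMap r =>
    intro b hb
    rw [AlgHom.commutes, ← Algebra.commutes, ← Algebra.smul_def]
    exact smul r b hb
  | ι x => intro b hb; exact mul_ι b x hb
  | mul a b iha ihb => intro c hc; rw [map_mul, ← mul_assoc]; exact ihb _ (iha _ hc)
  | add a b iha ihb => intro c hc; rw [map_add, mul_add]; exact add _ _ (iha _ hc) (ihb _ hc)

variable (K L) in
/-- The canonical map `L → U(L)`, as a linear map. -/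
def envι : L →ₗ[K] UniversalEnvelopingAlgebra K L :=
  (UniversalEnvelopingAlgebra.mkAlgHom K L).toLinearMap ∘ₗ TensorAlgebra.ι K

attribute [local instance] LieRing.ofAssociativeRing in
theorem enveloping_ι_lie (u v : L) :
    UniversalEnvelopingAlgebra.ι K ⁅u, v⁆ =
      UniversalEnvelopingAlgebra.ι K u * UniversalEnvelopingAlgebra.ι K v -
        UniversalEnvelopingAlgebra.ι K v * UniversalEnvelopingAlgebra.ι K u := by
  rw [LieHom.map_lie, LieRing.of_associative_ring_bracket]

/-- `r` is a right action of the Lie algebra `L` on `M`: writing `m ◁ u` for `r u m`, the law is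
`m ◁ ⁅u, v⁆ = (m ◁ u) ◁ v - (m ◁ v) ◁ u`. -/
def IsRightAction (r : L →ₗ[K] Module.End K M) : Prop :=
  ∀ u v m, r ⁅u, v⁆ m = r v (r u m) - r u (r v m)

namespace IsRightAction

variable {r : L →ₗ[K] Module.End K M} (hr : IsRightAction r)

attribute [local instance] LieRing.ofAssociativeRing in
/-- The right action of `U(L)` on `M` induced by a right action of `L`, as a morphism to the
opposite algebra. -/
def envHom : UniversalEnvelopingAlgebra K L →ₐ[K] (Module.End K M)ᵐᵒᵖ :=
  UniversalEnvelopingAlgebra.lift K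
    { (MulOpposite.opLinearEquiv K).toLinearMap ∘ₗ r with
      map_lie' := fun {u v} => by
        apply MulOpposite.unop_injective
        ext m
        simp [hr u v m, LieRing.of_associative_ring_bracket] }

/-- The map `m ↦ (p ↦ m ◁ p)`, for `m ∈ M` and `p ∈ U(L)`. -/
def envOrbit : M →ₗ[K] UniversalEnvelopingAlgebra K L →ₗ[K] M :=
  LinearMap.flip ((MulOpposite.opLinearEquiv K).symm.toLinearMap ∘ₗ hr.envHom.toLinearMap)

theorem envOrbit_one (m : M) : hr.envOrbit m 1 = m := by simp [envOrbit]

theorem envOrbit_mul_ι (m : M) (p : UniversalEnvelopingAlgebra K L) (u : L) :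
    hr.envOrbit m (p * UniversalEnvelopingAlgebra.ι K u) = r u (hr.envOrbit m p) := by
  have h : hr.envHom (UniversalEnvelopingAlgebra.ι K u) = MulOpposite.op (r u) :=
    UniversalEnvelopingAlgebra.lift_ι_apply K _ u
  simp only [envOrbit, LinearMap.flip_apply, LinearMap.comp_apply, AlgHom.toLinearMap_apply,
    map_mul, h]
  simp

end IsRightAction

section Cocycle

variable {N : Type*} [AddCommGroup N] [Module K N] [Module (UniversalEnvelopingAlgebra K L) N]
  [IsScalarTower K (UniversalEnvelopingAlgebra K L) N]

/-- `c` is a 1-cocycle with values in the `U(L)`-bimodule `N`, on which `U(L)` acts on the right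
through `r`; equivalently, `c` extends to a derivation of `U(L)` with values in `N`. -/
structure IsCocycle (r : L →ₗ[K] Module.End K N) (c : L →ₗ[K] N) : Prop where
  isRightAction : IsRightAction r
  map_smul : ∀ u (p : UniversalEnvelopingAlgebra K L) n, r u (p • n) = p • r u n
  map_lie : ∀ u v, c ⁅u, v⁆ =
    r v (c u) + UniversalEnvelopingAlgebra.ι K u • c v -
      (r u (c v) + UniversalEnvelopingAlgebra.ι K v • c u)

/-- The right action of `L` on `U(L) × N` for which `(p, d p) ◁ u = (p * u, d (p * u))` whenever
`d` is a derivation that extends `c`. -/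
def pairAction (r : L →ₗ[K] Module.End K N) (c : L →ₗ[K] N) :
    L →ₗ[K] Module.End K (UniversalEnvelopingAlgebra K L × N) :=
  LinearMap.mk₂ K
    (fun u p => (p.1 * UniversalEnvelopingAlgebra.ι K u, r u p.2 + p.1 • c u))
    (fun u u' p => Prod.ext (by simp [mul_add]) (by simp; abel))
    (fun k u p => Prod.ext (by simp) (by simp [smul_add, smul_comm k p.1]))
    (fun u p q => Prod.ext (by simp [add_mul]) (by simp [add_smul]; abel))
    (fun k u p => Prod.ext (by simp) (by simp [smul_add]))

variable {r : L →ₗ[K] Module.End K N} {c : L →ₗ[K] N}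

theorem pairAction_apply (u : L) (p : UniversalEnvelopingAlgebra K L × N) :
    pairAction r c u p = (p.1 * UniversalEnvelopingAlgebra.ι K u, r u p.2 + p.1 • c u) := rfl

namespace IsCocycle

variable (hc : IsCocycle r c)
include hc

theorem isRightAction_pairAction : IsRightAction (pairAction r c) := by
  intro u v p
  refine Prod.ext ?_ ?_
  · simp only [pairAction_apply, Prod.fst_sub, enveloping_ι_lie, mul_sub, mul_assoc]
  · simp only [pairAction_apply, Prod.snd_sub, hc.isRightAction u v, hc.map_lie, map_add,
      hc.map_smul, smul_sub, smul_add, mul_smul]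
    abel

/-- The derivation of `U(L)` with values in `N` that extends the cocycle `c`. -/
def envDerivation : UniversalEnvelopingAlgebra K L →ₗ[K] N :=
  LinearMap.snd K _ _ ∘ₗ hc.isRightAction_pairAction.envOrbit (1, 0)

theorem envDerivation_one : hc.envDerivation 1 = 0 := by
  simp [envDerivation, IsRightAction.envOrbit_one]

theorem envDerivation_mul_ι (p : UniversalEnvelopingAlgebra K L) (u : L) :
    hc.envDerivation (p * UniversalEnvelopingAlgebra.ι K u) =
      r u (hc.envDerivation p) + p • c u := by
  have fst_envOrbit : ∀ q, (hc.isRightAction_pairAction.envOrbit (1, 0) q).1 = q := by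
    intro q
    induction q using enveloping_induction with
    | one => rw [IsRightAction.envOrbit_one]
    | mul_ι q u hq => rw [IsRightAction.envOrbit_mul_ι, pairAction_apply, hq]
    | add a b ha hb => rw [map_add, Prod.fst_add, ha, hb]
    | smul k a ha => rw [LinearMap.map_smul, Prod.smul_fst, ha]
  simp only [envDerivation, LinearMap.comp_apply, IsRightAction.envOrbit_mul_ι,
    LinearMap.snd_apply, pairAction_apply, fst_envOrbit]

end IsCocycle

end Cocycle

end EnvelopingAlgebra

section PreLie

variable (K L : Type*) [CommRing K] [RightPreLieRing L] [RightPreLieAlgebra K L]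

/-- The right product `X ↦ X • v` of `S(L)`: the derivation extending the right multiplication by
`v` in the pre-Lie algebra `L`. -/
def bulletRight : L →ₗ[K] Module.End K (SymmetricAlgebra K L) where
  toFun v := symDerivation ((LinearMap.mul K L).flip v)
  map_add' v w := by rw [map_add, map_add, Derivation.coe_add_linearMap]
  map_smul' c v := by
    rw [map_smul, map_smul, Derivation.coe_smul_linearMap, RingHom.id_apply]

/-- The right product `X ↦ X ⋆ v = X • v + X × v` of `S(L)`. -/
def starRight : L →ₗ[K] Module.End K (SymmetricAlgebra K L) :=
  bulletRight K L + (LinearMap.mul K (SymmetricAlgebra K L)).flip ∘ₗ ι K L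

variable {K L}

theorem mul_lie_eq (x u v : L) : x * ⁅u, v⁆ = x * u * v - x * v * u := by
  have h := RightPreLieRing.assoc_symm x u v
  simp only [associator_apply] at h
  rw [Ring.lie_def, mul_sub]
  linear_combination (norm := abel) -h

theorem lie_mul_eq (u v x : L) :
    ⁅u, v⁆ * x = ⁅u * x, v⁆ + ⁅u, v * x⁆ - u * (x * v) + v * (x * u) := by
  have h₁ := mul_lie_eq u v x
  have h₂ := mul_lie_eq v u x
  simp only [Ring.lie_def, mul_sub, sub_mul] at h₁ h₂ ⊢
  linear_combination (norm := abel) h₂ - h₁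

theorem isRightAction_mul_flip : IsRightAction (LinearMap.mul K L).flip :=
  fun u v x => mul_lie_eq x u v

theorem bulletRight_apply (v : L) (X : SymmetricAlgebra K L) :
    bulletRight K L v X = symDerivation ((LinearMap.mul K L).flip v) X := rfl

theorem bulletRight_one (v : L) : bulletRight K L v 1 = 0 :=
  Derivation.map_one_eq_zero _

theorem bulletRight_ι (u v : L) : bulletRight K L v (ι K L u) = ι K L (u * v) :=
  symDerivation_ι _ _

theorem bulletRight_mul (v : L) (X Y : SymmetricAlgebra K L) :
    bulletRight K L v (X * Y) = bulletRight K L v X * Y + X * bulletRight K L v Y := by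
  simp only [bulletRight_apply, Derivation.leibniz, smul_eq_mul]
  ring

theorem isRightAction_bulletRight : IsRightAction (bulletRight K L) := by
  intro u v X
  have flip_lie : (LinearMap.mul K L).flip ⁅u, v⁆ =
      ⁅(LinearMap.mul K L).flip v, (LinearMap.mul K L).flip u⁆ :=
    LinearMap.ext (isRightAction_mul_flip u v)
  simp only [bulletRight_apply, flip_lie, symDerivation_lie, Derivation.commutator_apply]

theorem starRight_apply (v : L) (X : SymmetricAlgebra K L) :
    starRight K L v X = bulletRight K L v X + X * ι K L v := rfl

theorem starRight_one (v : L) : starRight K L v 1 = ι K L v := by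
  rw [starRight_apply, bulletRight_one, zero_add, one_mul]

theorem starRight_mul (v : L) (X Y : SymmetricAlgebra K L) :
    starRight K L v (X * Y) = bulletRight K L v X * Y + X * starRight K L v Y := by
  simp only [starRight_apply, bulletRight_mul]
  ring

theorem isRightAction_starRight : IsRightAction (starRight K L) := by
  intro u v X
  rw [starRight_apply, isRightAction_bulletRight u v X, Ring.lie_def, map_sub]
  simp only [starRight_apply, map_add, bulletRight_mul, bulletRight_ι]
  ring

variable (K L) in
/-- The right action `(φ ◁ u)(v) = φ(v) u - φ(v * u)` of `L` on the linear maps `L → U(L)`. -/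
def homAction : L →ₗ[K] Module.End K (L →ₗ[K] UniversalEnvelopingAlgebra K L) :=
  LinearMap.mk₂ K
    (fun u φ => LinearMap.mulRight K (UniversalEnvelopingAlgebra.ι K u) ∘ₗ φ -
      φ ∘ₗ LinearMap.mulRight K u)
    (fun u u' φ => by ext v; simp [mul_add]; abel)
    (fun c u φ => by ext v; simp [smul_sub, mul_smul_comm c v u])
    (fun u φ ψ => by ext v; simp [add_mul]; abel)
    (fun c u φ => by ext v; simp [smul_sub])

theorem homAction_apply (u v : L) (φ : L →ₗ[K] UniversalEnvelopingAlgebra K L) :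
    homAction K L u φ v = φ v * UniversalEnvelopingAlgebra.ι K u - φ (v * u) := rfl

theorem isRightAction_homAction : IsRightAction (homAction K L) := by
  intro u v φ
  ext x
  simp only [homAction_apply, LinearMap.sub_apply, enveloping_ι_lie, mul_lie_eq, map_sub, mul_sub,
    sub_mul, mul_assoc]
  abel

variable (K L) in
/-- The linear map which sends `u` to the operator `v ↦ u * v`, with values in `L ⊆ U(L)`. -/
def mulCocycle : L →ₗ[K] L →ₗ[K] UniversalEnvelopingAlgebra K L :=
  (LinearMap.mul K L).compr₂ (envι K L)

theorem mulCocycle_apply (u v : L) :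
    mulCocycle K L u v = UniversalEnvelopingAlgebra.ι K (u * v) := rfl

theorem isCocycle_mulCocycle : IsCocycle (homAction K L) (mulCocycle K L) where
  isRightAction := isRightAction_homAction
  map_smul u p φ := by
    ext v
    simp only [homAction_apply, LinearMap.smul_apply, smul_eq_mul, mul_sub, mul_assoc]
  map_lie u v := by
    ext x
    simp only [mulCocycle_apply, lie_mul_eq, map_add, map_sub, enveloping_ι_lie,
      LinearMap.add_apply, LinearMap.sub_apply, homAction_apply, LinearMap.smul_apply, smul_eq_mul]
    abel

variable (K L) in
/-- The operation on `U(L)` which corresponds to `X • v` on `S(L)`. -/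
def envBullet : UniversalEnvelopingAlgebra K L →ₗ[K] L →ₗ[K] UniversalEnvelopingAlgebra K L :=
  isCocycle_mulCocycle.envDerivation

theorem envBullet_one (v : L) : envBullet K L 1 v = 0 := by
  rw [envBullet, IsCocycle.envDerivation_one, LinearMap.zero_apply]

theorem envBullet_mul_ι (p : UniversalEnvelopingAlgebra K L) (u v : L) :
    envBullet K L (p * UniversalEnvelopingAlgebra.ι K u) v =
      envBullet K L p v * UniversalEnvelopingAlgebra.ι K u - envBullet K L p (v * u) +
        p * UniversalEnvelopingAlgebra.ι K (u * v) := by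
  rw [envBullet, IsCocycle.envDerivation_mul_ι]
  rfl

theorem isRightAction_envBullet_flip : IsRightAction (envBullet K L).flip := by
  intro v w p
  simp only [LinearMap.flip_apply]
  induction p using enveloping_induction generalizing v w with
  | one => simp [envBullet_one]
  | mul_ι p u hp =>
    simp only [envBullet_mul_ι, map_sub, map_add, LinearMap.add_apply, LinearMap.sub_apply, hp,
      lie_mul_eq, mul_lie_eq, mul_sub, sub_mul]
    abel
  | add a b ha hb =>
    simp only [map_add, LinearMap.add_apply, ha, hb]
    abel
  | smul c a ha => simp only [map_smul, LinearMap.smul_apply, ← smul_sub, ha]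

variable (K L) in
/-- The operation on `U(L)` which corresponds to `X × v` on `S(L)`. -/
def envTimes : L →ₗ[K] Module.End K (UniversalEnvelopingAlgebra K L) :=
  (LinearMap.mul K (UniversalEnvelopingAlgebra K L)).flip ∘ₗ envι K L - (envBullet K L).flip

theorem envTimes_apply (v : L) (p : UniversalEnvelopingAlgebra K L) :
    envTimes K L v p = p * UniversalEnvelopingAlgebra.ι K v - envBullet K L p v := rfl

theorem envBullet_lie (p : UniversalEnvelopingAlgebra K L) (u v : L) :
    envBullet K L p ⁅u, v⁆ =
      envBullet K L (envBullet K L p u) v - envBullet K L (envBullet K L p v) u :=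
  isRightAction_envBullet_flip u v p

theorem envBullet_envTimes (p : UniversalEnvelopingAlgebra K L) (v w : L) :
    envBullet K L (envTimes K L w p) v =
      envTimes K L (w * v) p + envTimes K L w (envBullet K L p v) := by
  have h := envBullet_lie p v w
  rw [Ring.lie_def, map_sub] at h
  simp only [envTimes_apply, map_sub, LinearMap.sub_apply, envBullet_mul_ι]
  linear_combination (norm := abel) -h

theorem envTimes_commute (v w : L) : Commute (envTimes K L v) (envTimes K L w) := by
  refine LinearMap.ext fun p => ?_
  have h := envBullet_lie p v w
  have hι := congrArg (p * ·) (enveloping_ι_lie (K := K) v w)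
  simp only [Module.End.mul_apply]
  rw [envTimes_apply v, envTimes_apply w (envTimes K L v p), envBullet_envTimes,
    envBullet_envTimes]
  simp only [envTimes_apply, Ring.lie_def, map_sub, sub_mul, mul_sub, mul_assoc] at h hι ⊢
  linear_combination (norm := abel) hι - h

variable (K L) in
/-- The Poincaré–Birkhoff–Witt map `U(L) → S(L)`, which sends `u₁ ⋯ uₙ` to `u₁ ⋆ ⋯ ⋆ uₙ`. -/
def envToSym : UniversalEnvelopingAlgebra K L →ₗ[K] SymmetricAlgebra K L :=
  isRightAction_starRight.envOrbit 1

theorem envToSym_one : envToSym K L 1 = 1 := IsRightAction.envOrbit_one _ _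

theorem envToSym_mul_ι (p : UniversalEnvelopingAlgebra K L) (u : L) :
    envToSym K L (p * UniversalEnvelopingAlgebra.ι K u) = starRight K L u (envToSym K L p) :=
  IsRightAction.envOrbit_mul_ι _ _ _ _

theorem envToSym_ι (u : L) : envToSym K L (UniversalEnvelopingAlgebra.ι K u) = ι K L u := by
  rw [← one_mul (UniversalEnvelopingAlgebra.ι K u), envToSym_mul_ι, envToSym_one, starRight_one]

theorem envToSym_envBullet (p : UniversalEnvelopingAlgebra K L) (v : L) :
    envToSym K L (envBullet K L p v) = bulletRight K L v (envToSym K L p) := by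
  induction p using enveloping_induction generalizing v with
  | one => rw [envBullet_one, map_zero, envToSym_one, bulletRight_one]
  | mul_ι p u hp =>
    have h := isRightAction_bulletRight (K := K) u v (envToSym K L p)
    rw [Ring.lie_def, map_sub, LinearMap.sub_apply] at h
    rw [envBullet_mul_ι, map_add, map_sub, envToSym_mul_ι, envToSym_mul_ι, envToSym_mul_ι, hp, hp]
    simp only [starRight_apply, map_add, bulletRight_mul, bulletRight_ι]
    linear_combination h
  | add a b ha hb => simp only [map_add, LinearMap.add_apply, ha, hb]
  | smul c a ha => simp only [map_smul, LinearMap.smul_apply, ha]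

theorem envToSym_envTimes (p : UniversalEnvelopingAlgebra K L) (v : L) :
    envToSym K L (envTimes K L v p) = envToSym K L p * ι K L v := by
  rw [envTimes_apply, map_sub, envToSym_mul_ι, envToSym_envBullet, starRight_apply,
    add_sub_cancel_left]

variable (K L) in
/-- The inverse of the Poincaré–Birkhoff–Witt map `U(L) → S(L)`. -/
def symToEnv : SymmetricAlgebra K L →ₗ[K] UniversalEnvelopingAlgebra K L :=
  LinearMap.applyₗ 1 ∘ₗ (symAction (envTimes K L) envTimes_commute).toLinearMap

theorem symToEnv_one : symToEnv K L 1 = 1 := by simp [symToEnv]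

theorem symToEnv_mul_ι (X : SymmetricAlgebra K L) (v : L) :
    symToEnv K L (X * ι K L v) = envTimes K L v (symToEnv K L X) := by
  simp [symToEnv, mul_comm X, symAction_ι]

theorem symToEnv_bulletRight (X : SymmetricAlgebra K L) (v : L) :
    symToEnv K L (bulletRight K L v X) = envBullet K L (symToEnv K L X) v := by
  induction X using sym_induction with
  | one => rw [bulletRight_one, map_zero, symToEnv_one, envBullet_one]
  | mul_ι X w hX =>
    rw [bulletRight_mul, bulletRight_ι, map_add, symToEnv_mul_ι, symToEnv_mul_ι, symToEnv_mul_ι,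
      hX, envBullet_envTimes, add_comm]
  | add X Y hX hY => simp only [map_add, LinearMap.add_apply, hX, hY]
  | smul c X hX => simp only [map_smul, LinearMap.smul_apply, hX]

theorem symToEnv_starRight (X : SymmetricAlgebra K L) (v : L) :
    symToEnv K L (starRight K L v X) = symToEnv K L X * UniversalEnvelopingAlgebra.ι K v := by
  rw [starRight_apply, map_add, symToEnv_bulletRight, symToEnv_mul_ι, envTimes_apply,
    add_sub_cancel]

variable (K L) in
/-- The Poincaré–Birkhoff–Witt isomorphism `U(L) ≃ S(L)`, which sends `u₁ ⋯ uₙ` to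
`u₁ ⋆ ⋯ ⋆ uₙ`. -/
def envEquivSym : UniversalEnvelopingAlgebra K L ≃ₗ[K] SymmetricAlgebra K L :=
  LinearEquiv.ofLinearMap (envToSym K L) (symToEnv K L)
    (LinearMap.ext fun X => by
      rw [LinearMap.comp_apply, LinearMap.id_apply]
      induction X using sym_induction with
      | one => rw [symToEnv_one, envToSym_one]
      | mul_ι X v hX => rw [symToEnv_mul_ι, envToSym_envTimes, hX]
      | add X Y hX hY => rw [map_add, map_add, hX, hY]
      | smul c X hX => rw [map_smul, map_smul, hX])
    (LinearMap.ext fun p => by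
      rw [LinearMap.comp_apply, LinearMap.id_apply]
      induction p using enveloping_induction with
      | one => rw [envToSym_one, symToEnv_one]
      | mul_ι p u hp => rw [envToSym_mul_ι, symToEnv_starRight, hp]
      | add a b ha hb => rw [map_add, map_add, ha, hb]
      | smul c a ha => rw [map_smul, map_smul, ha])

theorem envEquivSym_apply (p : UniversalEnvelopingAlgebra K L) :
    envEquivSym K L p = envToSym K L p := rfl

theorem starRight_induction {P : SymmetricAlgebra K L → Prop} (one : P 1)
    (starRight : ∀ X v, P X → P (starRight K L v X))
    (add : ∀ X Y, P X → P Y → P (X + Y)) (smul : ∀ (c : K) X, P X → P (c • X))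
    (X : SymmetricAlgebra K L) : P X := by
  obtain ⟨p, rfl⟩ := (envEquivSym K L).surjective X
  rw [envEquivSym_apply]
  induction p using enveloping_induction with
  | one => rwa [envToSym_one]
  | mul_ι p u hp => rw [envToSym_mul_ι]; exact starRight _ _ hp
  | add a b ha hb => rw [map_add]; exact add _ _ ha hb
  | smul c a ha => rw [map_smul]; exact smul _ _ ha

end PreLie

section Coderivation

variable {K C A : Type*} [CommRing K] [AddCommGroup C] [Module K C] [Coalgebra K C]
  [Ring A] [Algebra K A]

/-- `T` is a coderivation of the coalgebra `C`:
`Δ(T c) = T c⁽¹⁾ ⊗ c⁽²⁾ + c⁽¹⁾ ⊗ T c⁽²⁾`. -/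
def IsCoderivation (T : Module.End K C) : Prop :=
  comul ∘ₗ T = (T.rTensor C + T.lTensor C) ∘ₗ comul (R := K)

theorem IsCoderivation.add {S T : Module.End K C} (hS : IsCoderivation S)
    (hT : IsCoderivation T) : IsCoderivation (S + T) := by
  rw [IsCoderivation] at *
  rw [LinearMap.comp_add, hS, hT, ← LinearMap.add_comp, LinearMap.rTensor_add,
    LinearMap.lTensor_add, add_add_add_comm]

theorem IsCoderivation.convMul_comp {T : Module.End K C} (hT : IsCoderivation T)
    {E E₁ E₂ : Module.End K A} (hE : ∀ a b, E (a * b) = E₁ a * b + a * E₂ b)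
    {φ ψ : C →ₗ[K] A} (hφ : ∀ c, φ (T c) = E₁ (φ c)) (hψ : ∀ c, ψ (T c) = E₂ (ψ c)) (c : C) :
    (WithConv.toConv φ * WithConv.toConv ψ) (T c) =
      E ((WithConv.toConv φ * WithConv.toConv ψ) c) := by
  have h : LinearMap.mul' K A ∘ₗ TensorProduct.map φ ψ ∘ₗ (T.rTensor C + T.lTensor C) =
      E ∘ₗ LinearMap.mul' K A ∘ₗ TensorProduct.map φ ψ := by
    ext a b
    simp [hE, hφ, hψ]
  simp only [LinearMap.convMul_apply]
  rw [← LinearMap.comp_apply comul T, hT]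
  exact LinearMap.congr_fun h (comul c)

theorem isCoderivation_mulRight {H : Type*} [Ring H] [Bialgebra K H] {v : H}
    (hv : comul (R := K) v = v ⊗ₜ 1 + 1 ⊗ₜ v) : IsCoderivation (LinearMap.mulRight K v) := by
  ext a
  simp only [LinearMap.comp_apply, LinearMap.mulRight_apply, Bialgebra.comul_mul, hv]
  induction comul (R := K) a using TensorProduct.induction_on with
  | zero => simp
  | tmul x y => simp [mul_add]
  | add x y hx hy => rw [add_mul, hx, hy, map_add]

end Coderivation

section SymmetricCoalgebra

variable {K M A : Type*} [CommRing K] [AddCommGroup M] [Module K M] [Ring A] [Algebra K A]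

theorem isCoderivation_symDerivation (φ : Module.End K M) :
    IsCoderivation (symDerivation φ).toLinearMap := by
  ext X
  simp only [LinearMap.comp_apply, Derivation.coeFn_coe]
  induction X using sym_induction with
  | one => simp [Bialgebra.comul_one, Algebra.TensorProduct.one_def]
  | mul_ι X m hX =>
    simp only [symDerivation_mul_ι, map_add, Bialgebra.comul_mul, comul_ι, hX]
    induction comul (R := K) X using TensorProduct.induction_on with
    | zero => simp
    | tmul x y =>
      simp only [LinearMap.add_apply, LinearMap.rTensor_tmul, LinearMap.lTensor_tmul,
        Derivation.coeFn_coe, mul_add, add_mul, Algebra.TensorProduct.tmul_mul_tmul, mul_one,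
        map_add, symDerivation_mul_ι, TensorProduct.add_tmul, TensorProduct.tmul_add]
      abel
    | add x y hx hy =>
      simp only [map_add, add_mul, mul_add] at hx hy ⊢
      linear_combination hx + hy
  | add X Y hX hY => simp only [map_add, hX, hY]
  | smul c X hX => rw [Derivation.map_smul, map_smul, map_smul, map_smul, hX]

variable {κ : Type*} [DecidableEq κ] (w : κ → M) (s : Finset κ)

theorem comul_prod_ι :
    comul (R := K) (∏ i ∈ s, ι K M (w i)) =
      ∑ t ∈ s.powerset, (∏ i ∈ s \ t, ι K M (w i)) ⊗ₜ ∏ i ∈ t, ι K M (w i) := by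
  rw [← Bialgebra.comulAlgHom_apply, map_prod]
  simp only [Bialgebra.comulAlgHom_apply, comul_ι, add_comm (_ ⊗ₜ[K] (1 : SymmetricAlgebra K M)),
    Finset.prod_add]
  refine Finset.sum_congr rfl fun t _ => ?_
  have left : ∏ i ∈ s \ t, ι K M (w i) ⊗ₜ[K] (1 : SymmetricAlgebra K M) =
      (∏ i ∈ s \ t, ι K M (w i)) ⊗ₜ 1 :=
    (map_prod (Algebra.TensorProduct.includeLeft (S := K)) _ _).symm
  have right : ∏ i ∈ t, (1 : SymmetricAlgebra K M) ⊗ₜ[K] ι K M (w i) =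
      1 ⊗ₜ ∏ i ∈ t, ι K M (w i) :=
    (map_prod Algebra.TensorProduct.includeRight _ _).symm
  rw [left, right, Algebra.TensorProduct.tmul_mul_tmul, one_mul, mul_one]

theorem counit_prod_ι :
    counit (R := K) (∏ i ∈ s, ι K M (w i)) = if s = ∅ then 1 else 0 := by
  rw [← Bialgebra.counitAlgHom_apply, map_prod]
  simp only [Bialgebra.counitAlgHom_apply, counit_ι, Finset.prod_const, zero_pow_eq,
    Finset.card_eq_zero]

theorem convMul_prod_ι (φ ψ : WithConv (SymmetricAlgebra K M →ₗ[K] A)) :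
    (φ * ψ) (∏ i ∈ s, ι K M (w i)) =
      ∑ t ∈ s.powerset, φ (∏ i ∈ s \ t, ι K M (w i)) * ψ (∏ i ∈ t, ι K M (w i)) := by
  rw [LinearMap.convMul_apply, comul_prod_ι]
  simp

theorem convMul_apply_one (φ ψ : WithConv (SymmetricAlgebra K M →ₗ[K] A)) :
    (φ * ψ) 1 = φ 1 * ψ 1 := by
  rw [LinearMap.convMul_apply, Bialgebra.comul_one, Algebra.TensorProduct.one_def]
  simp

theorem convMul_apply_ι (φ ψ : WithConv (SymmetricAlgebra K M →ₗ[K] A)) (m : M) :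
    (φ * ψ) (ι K M m) = φ (ι K M m) * ψ 1 + φ 1 * ψ (ι K M m) := by
  rw [LinearMap.convMul_apply, comul_ι]
  simp

theorem eq_zero_of_isIdempotentElem {g : WithConv (SymmetricAlgebra K M →ₗ[K] A)}
    (hg : IsIdempotentElem g) (g_one : g 1 = 0) : g = 0 := by
  refine WithConv.ofConv_injective (sym_linearMap_ext fun k w => ?_)
  change g (∏ i, ι K M (w i)) = 0
  induction Finset.univ (α := Fin k) using Finset.strongInduction with
  | H s ih =>
    rw [← hg.eq, convMul_prod_ι]
    refine Finset.sum_eq_zero fun t ht => ?_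
    rcases (Finset.mem_powerset.1 ht).eq_or_ssubset with rfl | ht
    · rw [Finset.sdiff_self, Finset.prod_empty, g_one, zero_mul]
    · rw [ih t ht, mul_zero]

theorem eq_one_of_isIdempotentElem {g : WithConv (SymmetricAlgebra K M →ₗ[K] A)}
    (hg : IsIdempotentElem g) (g_one : g 1 = 1) : g = 1 := by
  refine (sub_eq_zero.1 (eq_zero_of_isIdempotentElem hg.one_sub ?_)).symm
  simp [g_one]

end SymmetricCoalgebra

section OudomGuin

variable {K L M : Type*} [CommRing K] [RightPreLieRing L] [RightPreLieAlgebra K L]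
  [AddCommGroup M] [Module K M]

theorem isCoderivation_bulletRight (v : L) : IsCoderivation (bulletRight K L v) :=
  isCoderivation_symDerivation _

theorem isCoderivation_starRight (v : L) : IsCoderivation (starRight K L v) :=
  (isCoderivation_bulletRight v).add (isCoderivation_mulRight (comul_ι K L v))

theorem counit_starRight (v : L) (X : SymmetricAlgebra K L) :
    counit (R := K) (starRight K L v X) = 0 := by
  induction X using sym_induction with
  | one => rw [starRight_one, counit_ι]
  | mul_ι X w _ => simp [starRight_apply, bulletRight_mul, bulletRight_ι]
  | add X Y hX hY => rw [map_add, map_add, hX, hY, add_zero]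
  | smul c X hX => rw [map_smul, map_smul, hX, smul_zero]

namespace IsRightAction

variable {r : L →ₗ[K] Module.End K M} (hr : IsRightAction r)

/-- The right action of `S(L)` on `M` obtained from a right action of `L` through the
isomorphism of `U(L)` with `S(L)`; it maps `u₁ ⋆ ⋯ ⋆ uₙ` to the composite action
of `u₁`, …, `uₙ`. -/
def symOrbit : M →ₗ[K] SymmetricAlgebra K L →ₗ[K] M :=
  hr.envOrbit.compl₂ (symToEnv K L)

theorem symOrbit_one (m : M) : hr.symOrbit m 1 = m := by
  rw [symOrbit, LinearMap.compl₂_apply, symToEnv_one, envOrbit_one]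

theorem symOrbit_starRight (m : M) (v : L) (X : SymmetricAlgebra K L) :
    hr.symOrbit m (starRight K L v X) = r v (hr.symOrbit m X) := by
  rw [symOrbit, LinearMap.compl₂_apply, symToEnv_starRight, envOrbit_mul_ι,
    LinearMap.compl₂_apply]

theorem symOrbit_ι (m : M) (v : L) : hr.symOrbit m (ι K L v) = r v m := by
  rw [← starRight_one, symOrbit_starRight, symOrbit_one]

theorem eq_symOrbit {T : SymmetricAlgebra K L →ₗ[K] M} {m : M} (hT_one : T 1 = m)
    (hT : ∀ v X, T (starRight K L v X) = r v (T X)) : T = hr.symOrbit m := by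
  ext X
  induction X using starRight_induction with
  | one => rw [hT_one, symOrbit_one]
  | starRight X v hX => rw [hT, hX, symOrbit_starRight]
  | add X Y hX hY => rw [map_add, map_add, hX, hY]
  | smul c X hX => rw [map_smul, map_smul, hX]

end IsRightAction

variable (K L)

/-- The Oudom–Guin extension `X • Y` to `S(L)` of the product of the pre-Lie algebra `L`. -/
def oudomGuin : SymmetricAlgebra K L →ₗ[K] SymmetricAlgebra K L →ₗ[K] SymmetricAlgebra K L :=
  isRightAction_bulletRight.symOrbit

/-- The action `u • X ∈ L` of `X ∈ S(L)` on `u ∈ L`. -/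
def preLieOrbit : L →ₗ[K] SymmetricAlgebra K L →ₗ[K] L :=
  isRightAction_mul_flip.symOrbit

/-- The associative product `X ⋆ Y` of `S(L)`. -/
def starProd : SymmetricAlgebra K L →ₗ[K] SymmetricAlgebra K L →ₗ[K] SymmetricAlgebra K L :=
  isRightAction_starRight.symOrbit

variable {K L}

theorem oudomGuin_one (X : SymmetricAlgebra K L) : oudomGuin K L X 1 = X :=
  IsRightAction.symOrbit_one _ X

theorem oudomGuin_ι (X : SymmetricAlgebra K L) (v : L) :
    oudomGuin K L X (ι K L v) = bulletRight K L v X :=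
  IsRightAction.symOrbit_ι _ X v

theorem oudomGuin_starRight (X Y : SymmetricAlgebra K L) (v : L) :
    oudomGuin K L X (starRight K L v Y) = bulletRight K L v (oudomGuin K L X Y) :=
  IsRightAction.symOrbit_starRight _ X v Y

theorem oudomGuin_mul_ι (X Y : SymmetricAlgebra K L) (v : L) :
    oudomGuin K L X (Y * ι K L v) =
      oudomGuin K L (oudomGuin K L X Y) (ι K L v) -
        oudomGuin K L X (oudomGuin K L Y (ι K L v)) := by
  have h := oudomGuin_starRight X Y v
  rw [starRight_apply, map_add] at h
  rw [oudomGuin_ι, oudomGuin_ι, ← h, add_sub_cancel_left]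

theorem oudomGuin_mul (X Y : SymmetricAlgebra K L) :
    oudomGuin K L (X * Y) =
      (WithConv.toConv (oudomGuin K L X) * WithConv.toConv (oudomGuin K L Y)).ofConv :=
  (isRightAction_bulletRight.eq_symOrbit
    (by rw [convMul_apply_one, WithConv.ofConv_toConv, WithConv.ofConv_toConv, oudomGuin_one,
      oudomGuin_one])
    fun v => (isCoderivation_starRight v).convMul_comp (bulletRight_mul v)
      (oudomGuin_starRight X · v) (oudomGuin_starRight Y · v)).symm

theorem preLieOrbit_one (u : L) : preLieOrbit K L u 1 = u :=
  IsRightAction.symOrbit_one _ u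

theorem preLieOrbit_starRight (u v : L) (X : SymmetricAlgebra K L) :
    preLieOrbit K L u (starRight K L v X) = preLieOrbit K L u X * v :=
  IsRightAction.symOrbit_starRight _ u v X

theorem eq_preLieOrbit {T : SymmetricAlgebra K L →ₗ[K] L} {u : L} (hT_one : T 1 = u)
    (hT : ∀ v X, T (starRight K L v X) = T X * v) : T = preLieOrbit K L u :=
  isRightAction_mul_flip.eq_symOrbit hT_one hT

theorem oudomGuin_ι_left (u : L) :
    oudomGuin K L (ι K L u) = ι K L ∘ₗ preLieOrbit K L u :=
  (isRightAction_bulletRight.eq_symOrbit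
    (by rw [LinearMap.comp_apply, preLieOrbit_one])
    fun v X => by
      simp only [LinearMap.comp_apply, preLieOrbit_starRight, bulletRight_ι]).symm

theorem preLieOrbit_of_mul_eq_zero {u : L} (hu : ∀ v, u * v = 0) :
    preLieOrbit K L u = LinearMap.toSpanSingleton K L u ∘ₗ counit :=
  (eq_preLieOrbit (by simp) fun v X => by simp [counit_starRight, smul_mul_assoc, hu]).symm

theorem starProd_starRight (X Y : SymmetricAlgebra K L) (v : L) :
    starProd K L X (starRight K L v Y) = starRight K L v (starProd K L X Y) :=
  IsRightAction.symOrbit_starRight _ X v Y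

theorem starProd_one (X : SymmetricAlgebra K L) : starProd K L X 1 = X :=
  IsRightAction.symOrbit_one _ X

theorem one_starProd : starProd K L 1 = LinearMap.id :=
  (isRightAction_starRight.eq_symOrbit (LinearMap.id_apply _) fun _ _ => rfl).symm

theorem starProd_assoc (X Y Z : SymmetricAlgebra K L) :
    starProd K L (starProd K L X Y) Z = starProd K L X (starProd K L Y Z) := by
  have h : starProd K L X ∘ₗ starProd K L Y = starProd K L (starProd K L X Y) :=
    isRightAction_starRight.eq_symOrbit (by rw [LinearMap.comp_apply, starProd_one])
      fun v Z => by simp only [LinearMap.comp_apply, starProd_starRight]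
  exact (LinearMap.congr_fun h Z).symm

theorem starProd_eq_convMul (X : SymmetricAlgebra K L) :
    starProd K L X =
      (WithConv.toConv (oudomGuin K L X) * WithConv.toConv LinearMap.id).ofConv :=
  (isRightAction_starRight.eq_symOrbit
    (by rw [convMul_apply_one, WithConv.ofConv_toConv, WithConv.ofConv_toConv, oudomGuin_one,
      LinearMap.id_apply, mul_one])
    fun v => (isCoderivation_starRight v).convMul_comp (starRight_mul v)
      (oudomGuin_starRight X · v) fun _ => rfl).symm

theorem envEquivSym_mul (p q : UniversalEnvelopingAlgebra K L) :
    envEquivSym K L (p * q) = starProd K L (envEquivSym K L p) (envEquivSym K L q) := by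
  simp only [envEquivSym_apply]
  induction q using enveloping_induction with
  | one => rw [mul_one, envToSym_one, starProd_one]
  | mul_ι q u hq =>
    rw [← mul_assoc, envToSym_mul_ι, hq, envToSym_mul_ι, starProd_starRight]
  | add a b ha hb => rw [mul_add, map_add, ha, hb, map_add, map_add]
  | smul c a ha => rw [mul_smul_comm, map_smul, ha, map_smul, map_smul]

end OudomGuin

section Shuffle

variable {K V : Type*} [CommRing K] [AddCommGroup V] [Module K V]

variable (K V) in
/-- The vector space `T(V)`, to be equipped with the shuffle product. -/
def ShuffleAlgebra : Type _ := TensorAlgebra K V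

instance : AddCommGroup (ShuffleAlgebra K V) :=
  inferInstanceAs (AddCommGroup (TensorAlgebra K V))

instance : Module K (ShuffleAlgebra K V) :=
  inferInstanceAs (Module K (TensorAlgebra K V))

variable (K V) in
/-- The identity map from `T(V)` to the shuffle algebra. -/
def toShuffle : TensorAlgebra K V ≃ₗ[K] ShuffleAlgebra K V := LinearEquiv.refl K _

instance : CommRing (ShuffleAlgebra K V) where
  __ := (inferInstance : AddCommGroup (ShuffleAlgebra K V))
  mul a b := toShuffle K V (shuffle ((toShuffle K V).symm a) ((toShuffle K V).symm b))
  one := toShuffle K V 1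
  left_distrib a b c := by change toShuffle K V _ = toShuffle K V _ + toShuffle K V _; simp
  right_distrib a b c := by change toShuffle K V _ = toShuffle K V _ + toShuffle K V _; simp
  zero_mul a := by change toShuffle K V _ = 0; simp
  mul_zero a := by change toShuffle K V _ = 0; simp
  one_mul a := one_shuffle _
  mul_one a := shuffle_one _
  mul_assoc a b c := shuffle_assoc _ _ _
  mul_comm a b := shuffle_comm _ _

theorem toShuffle_shuffle (a b : TensorAlgebra K V) :
    toShuffle K V (shuffle a b) = toShuffle K V a * toShuffle K V b := rfl

theorem toShuffle_symm_mul (a b : ShuffleAlgebra K V) :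
    (toShuffle K V).symm (a * b) =
      shuffle ((toShuffle K V).symm a) ((toShuffle K V).symm b) := rfl

instance : Algebra K (ShuffleAlgebra K V) :=
  Algebra.ofModule
    (fun c a b => (toShuffle K V).symm.injective (by simp [toShuffle_symm_mul]))
    (fun c a b => (toShuffle K V).symm.injective (by simp [toShuffle_symm_mul]))

theorem toShuffle_shuffleProd {k : ℕ} (w : Fin k → TensorAlgebra K V) (s : Finset (Fin k)) :
    toShuffle K V (shuffleProd w s) = ∏ i ∈ s, toShuffle K V (w i) := by
  have toShuffle_foldr : ∀ l : List (Fin k),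
      toShuffle K V ((l.map w).foldr (fun a b => shuffle a b) 1) =
        (l.map fun i => toShuffle K V (w i)).prod := by
    intro l
    induction l with
    | nil => rfl
    | cons a l ih =>
      simp only [List.map_cons, List.foldr_cons, List.prod_cons, toShuffle_shuffle, ih]
  rw [shuffleProd, toShuffle_foldr, ← List.prod_toFinset _ ((List.nodup_finRange k).filter _)]
  congr 1
  ext i
  simp

variable (f : V →ₗ[K] V)

/-- The right product `a ↦ a • v`, as a derivation of the shuffle algebra. -/
def shuffleBulletRight (v : TensorAlgebra K V) :
    Derivation K (ShuffleAlgebra K V) (ShuffleAlgebra K V) :=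
  Derivation.mk' ((toShuffle K V).conj ((bullet f).flip v)) fun a b => by
    rw [LinearEquiv.conj_apply_apply, toShuffle_symm_mul, LinearMap.flip_apply, shuffle_bullet,
      map_add, toShuffle_shuffle, toShuffle_shuffle, add_comm]
    simp [LinearEquiv.conj_apply_apply, mul_comm b]

/-- The right product by `v` on the coefficients of polynomials over the shuffle algebra. -/
def coeffBullet (v : TensorAlgebra K V) :
    Derivation K (ShuffleAlgebra K V)[X] (ShuffleAlgebra K V)[X] :=
  PolynomialModule.equivPolynomialSelf.compDer (shuffleBulletRight f v).mapCoeffs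

theorem coeffBullet_monomial (v : TensorAlgebra K V) (n : ℕ) (a : ShuffleAlgebra K V) :
    coeffBullet f v (monomial n a) =
      monomial n (toShuffle K V (bullet f ((toShuffle K V).symm a) v)) := by
  simp only [coeffBullet, Derivation.linearEquiv_coe_comp, LinearMap.coe_comp,
    LinearMap.coe_restrictScalars, LinearEquiv.coe_coe, Derivation.coeFn_coe, Function.comp_apply,
    Derivation.mapCoeffs_monomial, PolynomialModule.equivPolynomialSelf_apply_eq,
    PolynomialModule.equivPolynomial_single]
  rfl

/-- The map `a Xⁿ ↦ fⁿ(x) a`, from polynomials over the shuffle algebra to `T(V)`. The variable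
`X` counts how many times `f` is applied to the letter `x`. -/
def letterMap : V →ₗ[K] (ShuffleAlgebra K V)[X] →ₗ[K] TensorAlgebra K V where
  toFun x := Polynomial.lsum fun n =>
    LinearMap.mulLeft K (TensorAlgebra.ι K ((f ^ n) x)) ∘ₗ (toShuffle K V).symm.toLinearMap
  map_add' x y := by
    ext p
    simp [Polynomial.sum_def, add_mul, Finset.sum_add_distrib]
  map_smul' c x := by
    ext p
    simp [Polynomial.sum_def, Finset.smul_sum]

theorem letterMap_monomial (x : V) (n : ℕ) (a : ShuffleAlgebra K V) :
    letterMap f x (monomial n a) = TensorAlgebra.ι K ((f ^ n) x) * (toShuffle K V).symm a := by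
  simp [letterMap, Polynomial.sum_monomial_index]

theorem letterMap_coeffBullet_add (x : V) (v : TensorAlgebra K V) (p : (ShuffleAlgebra K V)[X]) :
    letterMap f x (coeffBullet f v p + p * monomial 1 (toShuffle K V v)) =
      bullet f (letterMap f x p) v := by
  induction p using Polynomial.induction_on' with
  | add p q hp hq =>
    simp only [add_mul, map_add, LinearMap.add_apply, ← hp, ← hq]
    abel
  | monomial n a =>
    rw [coeffBullet_monomial, monomial_mul_monomial, map_add, letterMap_monomial,
      letterMap_monomial, letterMap_monomial, cons_bullet, pow_succ', toShuffle_symm_mul,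
      LinearEquiv.symm_apply_apply, LinearEquiv.symm_apply_apply, Module.End.mul_apply]

/-- The algebra morphism which maps `w₁ × ⋯ × w_k` to `(w₁ ⧢ ⋯ ⧢ w_k) Xᵏ`. -/
def shufflePoly : STVf f →ₐ[K] (ShuffleAlgebra K V)[X] :=
  SymmetricAlgebra.lift ((monomial 1).restrictScalars K ∘ₗ
    (toShuffle K V).toLinearMap ∘ₗ (toTVf f).symm.toLinearMap)

theorem shufflePoly_ι (v : TVf f) :
    shufflePoly f (ι K (TVf f) v) = monomial 1 (toShuffle K V ((toTVf f).symm v)) := by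
  simp [shufflePoly]

theorem shufflePoly_timesProd {k : ℕ} (w : Fin k → TensorAlgebra K V) (s : Finset (Fin k)) :
    shufflePoly f (timesProd f w s) = monomial s.card (toShuffle K V (shuffleProd w s)) := by
  have shufflePoly_incl : ∀ i, shufflePoly f (incl f (w i)) =
      C (toShuffle K V (w i)) * (X : (ShuffleAlgebra K V)[X]) := fun i =>
    (shufflePoly_ι f _).trans (C_mul_X_eq_monomial ..).symm
  rw [timesProd, map_prod, Finset.prod_congr rfl fun i _ => shufflePoly_incl i,
    Finset.prod_mul_distrib, Finset.prod_const, ← map_prod, C_mul_X_pow_eq_monomial,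
    toShuffle_shuffleProd]

theorem shufflePoly_bulletRight (v : TVf f) (Y : STVf f) :
    shufflePoly f (bulletRight K (TVf f) v Y) =
      coeffBullet f ((toTVf f).symm v) (shufflePoly f Y) := by
  induction Y using sym_induction with
  | one => rw [bulletRight_one, map_zero, map_one, Derivation.map_one_eq_zero]
  | mul_ι Y w hY =>
    rw [bulletRight_mul, bulletRight_ι, map_add (shufflePoly f), map_mul (shufflePoly f),
      map_mul (shufflePoly f), map_mul (shufflePoly f), hY, Derivation.leibniz, shufflePoly_ι,
      shufflePoly_ι, coeffBullet_monomial, LinearEquiv.symm_apply_apply, TVf_mul_def,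
      LinearEquiv.symm_apply_apply, smul_eq_mul, smul_eq_mul, add_comm,
      mul_comm (coeffBullet _ _ _)]
  | add X Y hX hY => rw [map_add, map_add, hX, hY, map_add, map_add]
  | smul c X hX => rw [map_smul, map_smul, hX, map_smul, Derivation.map_smul]

theorem shufflePoly_starRight (v : TVf f) (Y : STVf f) :
    shufflePoly f (starRight K (TVf f) v Y) =
      coeffBullet f ((toTVf f).symm v) (shufflePoly f Y) +
        shufflePoly f Y * monomial 1 (toShuffle K V ((toTVf f).symm v)) := by
  rw [starRight_apply, map_add, map_mul, shufflePoly_bulletRight, shufflePoly_ι]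

end Shuffle

section WordOrbit

variable {K V : Type*} [CommRing K] [AddCommGroup V] [Module K V] (f : V →ₗ[K] V)

/-- The action `u • X` of `X ∈ S(T(V, f))` on `u ∈ T(V)`. -/
def wordOrbit : TensorAlgebra K V →ₗ[K] STVf f →ₗ[K] TensorAlgebra K V :=
  (preLieOrbit K (TVf f) ∘ₗ (toTVf f).toLinearMap).compr₂ (toTVf f).symm.toLinearMap

theorem oudomGuin_incl (u : TensorAlgebra K V) (X : STVf f) :
    oudomGuin K (TVf f) (incl f u) X = incl f (wordOrbit f u X) :=
  LinearMap.congr_fun (oudomGuin_ι_left (K := K) (L := TVf f) (toTVf f u)) X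

theorem wordOrbit_one_left :
    wordOrbit f 1 = LinearMap.toSpanSingleton K (TensorAlgebra K V) 1 ∘ₗ counit := by
  have h := preLieOrbit_of_mul_eq_zero (K := K) (L := TVf f) (u := toTVf f 1) fun v => by
    rw [TVf_mul_def, LinearEquiv.symm_apply_apply, one_bullet, map_zero]
  ext X
  exact congrArg (toTVf f).symm (LinearMap.congr_fun h X)

theorem wordOrbit_one (u : TensorAlgebra K V) : wordOrbit f u 1 = u :=
  preLieOrbit_one (K := K) (L := TVf f) (toTVf f u)

theorem wordOrbit_starRight (u : TensorAlgebra K V) (v : TVf f) (X : STVf f) :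
    wordOrbit f u (starRight K (TVf f) v X) =
      bullet f (wordOrbit f u X) ((toTVf f).symm v) :=
  preLieOrbit_starRight (K := K) (L := TVf f) (toTVf f u) v X

theorem eq_wordOrbit {T : STVf f →ₗ[K] TensorAlgebra K V} {u : TensorAlgebra K V}
    (hT_one : T 1 = u)
    (hT : ∀ v X, T (starRight K (TVf f) v X) = bullet f (T X) ((toTVf f).symm v)) :
    T = wordOrbit f u := by
  have h := eq_preLieOrbit (K := K) (L := TVf f) (T := (toTVf f).toLinearMap ∘ₗ T)
    (congrArg (toTVf f) hT_one) fun v X => congrArg (toTVf f) (hT v X)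
  ext X
  exact congrArg (toTVf f).symm (LinearMap.congr_fun h X)

/-- The inclusion of `T(V)` in the polynomials over the shuffle algebra, as constants. -/
def shuffleC : TensorAlgebra K V →ₗ[K] (ShuffleAlgebra K V)[X] :=
  (monomial 0).restrictScalars K ∘ₗ (toShuffle K V).toLinearMap

theorem shuffleC_apply (a : TensorAlgebra K V) :
    shuffleC a = monomial 0 (toShuffle K V a) := rfl

theorem wordOrbit_cons (x : V) (u : TensorAlgebra K V) :
    wordOrbit f (TensorAlgebra.ι K x * u) =
      letterMap f x ∘ₗ
        (WithConv.toConv (shuffleC ∘ₗ wordOrbit f u) *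
          WithConv.toConv (shufflePoly f).toLinearMap).ofConv := by
  refine (eq_wordOrbit f ?_ fun v X => ?_).symm
  · rw [LinearMap.comp_apply, convMul_apply_one, WithConv.ofConv_toConv, WithConv.ofConv_toConv,
      LinearMap.comp_apply, shuffleC_apply, wordOrbit_one, AlgHom.toLinearMap_apply, map_one,
      mul_one, letterMap_monomial, pow_zero, LinearEquiv.symm_apply_apply, Module.End.one_apply]
  · let D : Module.End K (ShuffleAlgebra K V)[X] := (coeffBullet f ((toTVf f).symm v)).toLinearMap
    let E := D + LinearMap.mulRight K (monomial 1 (toShuffle K V ((toTVf f).symm v)))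
    have hE : ∀ p q, E (p * q) = D p * q + p * E q := fun p q => by
      simp only [E, D, LinearMap.add_apply, LinearMap.mulRight_apply, Derivation.coeFn_coe,
        Derivation.leibniz, smul_eq_mul]
      ring
    have hφ : ∀ Y, (shuffleC ∘ₗ wordOrbit f u) (starRight K (TVf f) v Y) =
        D ((shuffleC ∘ₗ wordOrbit f u) Y) := fun Y => by
      rw [LinearMap.comp_apply, LinearMap.comp_apply, wordOrbit_starRight, shuffleC_apply,
        shuffleC_apply]
      exact (coeffBullet_monomial f _ _ _).symm
    have hψ : ∀ Y, (shufflePoly f).toLinearMap (starRight K (TVf f) v Y) =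
        E ((shufflePoly f).toLinearMap Y) := fun Y => shufflePoly_starRight f v Y
    have h := (isCoderivation_starRight (K := K) (L := TVf f) v).convMul_comp hE hφ hψ X
    rw [LinearMap.comp_apply, LinearMap.comp_apply, ← letterMap_coeffBullet_add]
    exact congrArg (letterMap f x) h

end WordOrbit

section OudomGuinExtension

variable {K V : Type*} [CommRing K] [AddCommGroup V] [Module K V] (f : V →ₗ[K] V)

theorem incl_injective : Function.Injective (incl f) :=
  symι_injective.comp (toTVf f).injective

theorem star_oudomGuin (X Y : STVf f) :
    star (oudomGuin K (TVf f)) X Y = starProd K (TVf f) X Y := by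
  rw [star]
  exact (LinearMap.congr_fun (starProd_eq_convMul (K := K) (L := TVf f) X) Y).symm

theorem isOudomGuinExtension_oudomGuin :
    IsOudomGuinExtension f (oudomGuin K (TVf f)) where
  extends_bullet _ _ :=
    (oudomGuin_ι (K := K) (L := TVf f) _ _).trans (bulletRight_ι (K := K) (L := TVf f) _ _)
  apply_one := oudomGuin_one (K := K) (L := TVf f)
  incl_mul u v X := oudomGuin_mul_ι (K := K) (L := TVf f) (incl f u) X (toTVf f v)
  mul_apply X Y := LinearMap.congr_fun (oudomGuin_mul (K := K) (L := TVf f) X Y)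

namespace IsOudomGuinExtension

variable {f} {B : STVf f →ₗ[K] STVf f →ₗ[K] STVf f} (hB : IsOudomGuinExtension f B)
include hB

theorem mul_eq_convMul (X Y : STVf f) :
    B (X * Y) = (WithConv.toConv (B X) * WithConv.toConv (B Y)).ofConv :=
  LinearMap.ext (hB.mul_apply X Y)

theorem one_left : WithConv.toConv (B 1) = 1 := by
  refine eq_one_of_isIdempotentElem (K := K) (M := TVf f) ?_ (hB.apply_one 1)
  rw [IsIdempotentElem, ← WithConv.toConv_ofConv (_ * _), ← hB.mul_eq_convMul, mul_one]

theorem ι_right (X : STVf f) (v : TVf f) :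
    B X (ι K (TVf f) v) = bulletRight K (TVf f) v X := by
  induction X using sym_induction with
  | one =>
    rw [bulletRight_one (K := K) (L := TVf f), ← WithConv.ofConv_toConv (B 1), hB.one_left]
    simp
  | mul_ι X w hX =>
    rw [hB.mul_eq_convMul, convMul_apply_ι, WithConv.ofConv_toConv, WithConv.ofConv_toConv, hX,
      hB.apply_one, hB.apply_one, bulletRight_mul (K := K) (L := TVf f),
      bulletRight_ι (K := K) (L := TVf f)]
    exact congrArg (_ + X * ·) (hB.extends_bullet ((toTVf f).symm w) ((toTVf f).symm v))
  | add X Y hX hY => rw [map_add, map_add, LinearMap.add_apply, hX, hY]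
  | smul c X hX => rw [map_smul, map_smul, LinearMap.smul_apply, hX]

theorem ι_starRight (u v : TVf f) (X : STVf f) :
    B (ι K (TVf f) u) (starRight K (TVf f) v X) =
      bulletRight K (TVf f) v (B (ι K (TVf f) u) X) := by
  have h : B (ι K (TVf f) u) (X * ι K (TVf f) v) = _ :=
    hB.incl_mul ((toTVf f).symm u) ((toTVf f).symm v) X
  rw [starRight_apply (K := K) (L := TVf f), map_add, ← hB.ι_right, ← hB.ι_right, h]
  exact add_sub_cancel _ _

theorem eq_oudomGuin : B = oudomGuin K (TVf f) := by
  have eq_on_ι : ∀ u, B (ι K (TVf f) u) = oudomGuin K (TVf f) (ι K (TVf f) u) := fun u => by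
    ext X
    induction X using starRight_induction (K := K) (L := TVf f) with
    | one => rw [hB.apply_one, oudomGuin_one (K := K) (L := TVf f)]
    | starRight X v hX => rw [hB.ι_starRight, hX, oudomGuin_starRight (K := K) (L := TVf f)]
    | add X Y hX hY => rw [map_add, map_add, hX, hY]
    | smul c X hX => rw [map_smul, map_smul, hX]
  refine LinearMap.ext fun X => ?_
  induction X using sym_induction with
  | one =>
    exact WithConv.toConv_injective
      (hB.one_left.trans (isOudomGuinExtension_oudomGuin f).one_left.symm)
  | mul_ι X u hX =>
    rw [hB.mul_eq_convMul, (isOudomGuinExtension_oudomGuin f).mul_eq_convMul, hX, eq_on_ι]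
  | add X Y hX hY => rw [map_add, map_add, hX, hY]
  | smul c X hX => rw [map_smul, map_smul, hX]

end IsOudomGuinExtension

end OudomGuinExtension

section DisjointFamilies

variable {κ : Type*} [Fintype κ] [DecidableEq κ] {n : ℕ} {s : Finset κ}

/-- The families of `n` pairwise disjoint, possibly empty, sets with union `s`;
`orderedPartitions n k` is the case where `s` is all of `Fin k`. -/
def disjointFamilies (n : ℕ) (s : Finset κ) : Finset (Fin n → Finset κ) :=
  Finset.univ.filter fun P =>
    (∀ a b, a ≠ b → Disjoint (P a) (P b)) ∧ Finset.univ.biUnion P = s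

theorem insertNth_mem_disjointFamilies {p : Fin (n + 1)} {t : Finset κ}
    {Q : Fin n → Finset κ} :
    p.insertNth t Q ∈ disjointFamilies (n + 1) s ↔ t ⊆ s ∧ Q ∈ disjointFamilies n (s \ t) := by
  have pairwise_iff : (∀ a b, a ≠ b →
      Disjoint ((p.insertNth t Q : Fin (n + 1) → Finset κ) a)
        ((p.insertNth t Q : Fin (n + 1) → Finset κ) b)) ↔
        Disjoint t (Finset.univ.biUnion Q) ∧ ∀ a b, a ≠ b → Disjoint (Q a) (Q b) := by
    simp only [Fin.forall_iff_succAbove p, Fin.insertNth_apply_same, Fin.insertNth_apply_succAbove,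
      Finset.disjoint_biUnion_right, disjoint_comm (b := t)]
    simp only [ne_eq, not_true_eq_false, false_imp_iff, true_and, Fin.succAbove_right_inj,
      Fin.succAbove_ne, Fin.ne_succAbove, not_false_eq_true, forall_const, Finset.mem_univ,
      forall_and]
    tauto
  have biUnion_eq : Finset.univ.biUnion (p.insertNth t Q : Fin (n + 1) → Finset κ) =
      t ∪ Finset.univ.biUnion Q := by
    ext i
    simp [Fin.exists_iff_succAbove p]
  have union_iff : ∀ u : Finset κ, Disjoint t u ∧ t ∪ u = s ↔ t ⊆ s ∧ u = s \ t := by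
    refine fun u => ⟨?_, ?_⟩
    · rintro ⟨h, rfl⟩
      exact ⟨Finset.subset_union_left, (Finset.union_sdiff_cancel_left h).symm⟩
    · rintro ⟨h, rfl⟩
      exact ⟨Finset.disjoint_sdiff, Finset.union_sdiff_of_subset h⟩
  simp only [disjointFamilies, Finset.mem_filter_univ, pairwise_iff, biUnion_eq]
  rw [and_right_comm, union_iff, and_assoc, and_comm (b := _ = _)]

theorem sum_disjointFamilies_succ {M : Type*} [AddCommMonoid M] (p : Fin (n + 1))
    (F : (Fin (n + 1) → Finset κ) → M) :
    ∑ P ∈ disjointFamilies (n + 1) s, F P =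
      ∑ t ∈ s.powerset, ∑ Q ∈ disjointFamilies n (s \ t), F (p.insertNth t Q) := by
  rw [Finset.sum_sigma']
  symm
  refine Finset.sum_nbij' (fun q => p.insertNth q.1 q.2) (fun P => ⟨P p, p.removeNth P⟩)
    ?_ ?_ (fun q _ => ?_) (fun P _ => p.insertNth_self_removeNth P) (fun _ _ => rfl)
  · rintro ⟨t, Q⟩ hQ
    rw [Finset.mem_sigma, Finset.mem_powerset] at hQ
    exact insertNth_mem_disjointFamilies.2 hQ
  · intro P hP
    rwa [Finset.mem_sigma, Finset.mem_powerset, ← insertNth_mem_disjointFamilies,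
      p.insertNth_self_removeNth]
  · simp

theorem disjointFamilies_zero :
    disjointFamilies 0 s = if s = ∅ then Finset.univ else ∅ := by
  simp [disjointFamilies, eq_comm (b := s), Finset.filter_const]

theorem disjointFamilies_one : disjointFamilies 1 s = {fun _ => s} := by
  ext P
  simp [disjointFamilies, Subsingleton.elim (_ : Fin 1) 0, funext_iff]

end DisjointFamilies

section Formulas

variable {K V : Type*} [CommRing K] [AddCommGroup V] [Module K V] (f : V →ₗ[K] V) {k : ℕ}
  (w : Fin k → TensorAlgebra K V) (s : Finset (Fin k))

theorem wordOrbit_one_timesProd :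
    wordOrbit f 1 (timesProd f w s) = if s = ∅ then 1 else 0 := by
  have h := counit_prod_ι (K := K) (M := TVf f) (fun i => toTVf f (w i)) s
  rw [wordOrbit_one_left, LinearMap.comp_apply]
  refine (congrArg (LinearMap.toSpanSingleton K (TensorAlgebra K V) 1) h).trans ?_
  simp

theorem wordOrbit_cons_timesProd (x : V) (u : TensorAlgebra K V) :
    wordOrbit f (TensorAlgebra.ι K x * u) (timesProd f w s) =
      ∑ t ∈ s.powerset, TensorAlgebra.ι K ((f ^ t.card) x) *
        shuffle (wordOrbit f u (timesProd f w (s \ t))) (shuffleProd w t) := by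
  have h := convMul_prod_ι (K := K) (M := TVf f) (fun i => toTVf f (w i)) s
    (WithConv.toConv (shuffleC ∘ₗ wordOrbit f u)) (WithConv.toConv (shufflePoly f).toLinearMap)
  rw [wordOrbit_cons, LinearMap.comp_apply]
  refine (congrArg (letterMap f x) h).trans ?_
  rw [map_sum]
  refine Finset.sum_congr rfl fun t _ => ?_
  change letterMap f x (shuffleC (wordOrbit f u (timesProd f w (s \ t))) *
    shufflePoly f (timesProd f w t)) = _
  rw [shuffleC_apply, shufflePoly_timesProd, monomial_mul_monomial, letterMap_monomial, zero_add,
    toShuffle_symm_mul, LinearEquiv.symm_apply_apply, LinearEquiv.symm_apply_apply]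

theorem starProd_incl_timesProd (u : TensorAlgebra K V) :
    starProd K (TVf f) (incl f u) (timesProd f w s) =
      ∑ t ∈ s.powerset, incl f (wordOrbit f u (timesProd f w (s \ t))) * timesProd f w t := by
  have h := convMul_prod_ι (K := K) (M := TVf f) (fun i => toTVf f (w i)) s
    (WithConv.toConv (oudomGuin K (TVf f) (incl f u))) (WithConv.toConv LinearMap.id)
  rw [starProd_eq_convMul (K := K) (L := TVf f)]
  refine Eq.trans h (Finset.sum_congr rfl fun t _ => ?_)
  exact congrArg (· * timesProd f w t) (oudomGuin_incl f u (timesProd f w (s \ t)))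

theorem starProd_incl_one_timesProd :
    starProd K (TVf f) (incl f 1) (timesProd f w s) = incl f 1 * timesProd f w s := by
  rw [starProd_incl_timesProd, Finset.sum_eq_single s]
  · rw [Finset.sdiff_self, wordOrbit_one_timesProd, if_pos rfl]
  · intro t ht hts
    have not_subset : ¬ s ⊆ t := fun h => hts ((Finset.mem_powerset.1 ht).antisymm h)
    rw [wordOrbit_one_timesProd, if_neg (mt Finset.sdiff_eq_empty_iff_subset.1 not_subset),
      map_zero, zero_mul]
  · exact fun hs => (hs (Finset.mem_powerset_self s)).elim

theorem wordOrbit_cons_timesProd_univ (x : V) (u : TensorAlgebra K V) :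
    wordOrbit f (TensorAlgebra.ι K x * u) (timesProd f w Finset.univ) =
      ∑ I : Finset (Fin k), TensorAlgebra.ι K ((f ^ (k - I.card)) x) *
        shuffle (wordOrbit f u (timesProd f w I)) (shuffleProd w Iᶜ) := by
  rw [wordOrbit_cons_timesProd, Finset.powerset_univ,
    ← Equiv.sum_comp (Function.Involutive.toPerm _ (compl_involutive (α := Finset (Fin k))))]
  simp [Finset.card_compl]

theorem starProd_cons_timesProd (x : V) (u : TensorAlgebra K V) :
    starProd K (TVf f) (incl f (TensorAlgebra.ι K x * u)) (timesProd f w s) =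
      ∑ P ∈ disjointFamilies 3 s, incl f (TensorAlgebra.ι K ((f ^ (P 1).card) x) *
        shuffle (wordOrbit f u (timesProd f w (P 0))) (shuffleProd w (P 1))) *
        timesProd f w (P 2) := by
  rw [starProd_incl_timesProd, sum_disjointFamilies_succ (Fin.last 2)]
  refine Finset.sum_congr rfl fun t _ => ?_
  rw [wordOrbit_cons_timesProd, map_sum, Finset.sum_mul, sum_disjointFamilies_succ (Fin.last 1)]
  refine Finset.sum_congr rfl fun t' _ => ?_
  rw [disjointFamilies_one, Finset.sum_singleton]
  rfl

theorem wordOrbit_tprod_timesProd (i : ℕ) (x : Fin i → V) :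
    wordOrbit f (TensorAlgebra.tprod K V i x) (timesProd f w s) =
      ∑ P ∈ disjointFamilies i s, nested f w i x P := by
  induction i generalizing s with
  | zero =>
    rw [TensorAlgebra.tprod_apply, List.ofFn_zero, List.prod_nil, wordOrbit_one_timesProd,
      disjointFamilies_zero]
    split_ifs <;> simp [nested]
  | succ i ih =>
    have tprod_succ : TensorAlgebra.tprod K V (i + 1) x =
        TensorAlgebra.ι K (x 0) * TensorAlgebra.tprod K V i fun j => x j.succ := by
      simp [TensorAlgebra.tprod_apply, List.ofFn_succ]
    rw [tprod_succ, wordOrbit_cons_timesProd, sum_disjointFamilies_succ 0]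
    refine Finset.sum_congr rfl fun t _ => ?_
    rw [ih, map_sum, LinearMap.sum_apply, Finset.mul_sum]
    refine Finset.sum_congr rfl fun Q _ => ?_
    simp [nested]

theorem starProd_tprod_timesProd (i : ℕ) (x : Fin i → V) :
    starProd K (TVf f) (incl f (TensorAlgebra.tprod K V i x)) (timesProd f w s) =
      ∑ P ∈ disjointFamilies (i + 1) s,
        incl f (nested f w i x fun j => P j.castSucc) * timesProd f w (P (Fin.last i)) := by
  rw [starProd_incl_timesProd, sum_disjointFamilies_succ (Fin.last i)]
  refine Finset.sum_congr rfl fun t _ => ?_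
  rw [wordOrbit_tprod_timesProd, map_sum, Finset.sum_mul]
  simp [Fin.insertNth_last']

end Formulas

end ComPreLie

end

theorem mainTheorem7_general {K : Type*} [CommRing K] {V : Type*} [AddCommGroup V] [Module K V]
    (f : V →ₗ[K] V) :
    ∃ (B : ComPreLie.STVf f →ₗ[K] ComPreLie.STVf f →ₗ[K] ComPreLie.STVf f)
      (b : TensorAlgebra K V →ₗ[K] ComPreLie.STVf f →ₗ[K] TensorAlgebra K V),
      ComPreLie.IsOudomGuinExtension f B ∧
      (∀ B', ComPreLie.IsOudomGuinExtension f B' → B' = B) ∧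
      Function.Injective (ComPreLie.incl f) ∧
      (∀ u X, B (ComPreLie.incl f u) X = ComPreLie.incl f (b u X)) ∧
      (∀ X Y Z, ComPreLie.star B (ComPreLie.star B X Y) Z =
        ComPreLie.star B X (ComPreLie.star B Y Z)) ∧
      (∀ X, ComPreLie.star B 1 X = X ∧ ComPreLie.star B X 1 = X) ∧
      (∃ e : UniversalEnvelopingAlgebra K (ComPreLie.TVf f) ≃ₗ[K] ComPreLie.STVf f,
        e 1 = 1 ∧
        (∀ p q, e (p * q) = ComPreLie.star B (e p) (e q)) ∧
        ∀ u : ComPreLie.TVf f, e (UniversalEnvelopingAlgebra.ι K u) =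
          SymmetricAlgebra.ι K (ComPreLie.TVf f) u) ∧
      (∀ (k : ℕ) (w' : Fin k → TensorAlgebra K V), 1 ≤ k →
        b 1 (ComPreLie.timesProd f w' Finset.univ) = 0) ∧
      (∀ (k : ℕ) (w' : Fin k → TensorAlgebra K V) (x : V) (w : TensorAlgebra K V),
        b (TensorAlgebra.ι K x * w) (ComPreLie.timesProd f w' Finset.univ) =
          ∑ I : Finset (Fin k), TensorAlgebra.ι K ((f ^ (k - I.card)) x) *
            ComPreLie.shuffle (b w (ComPreLie.timesProd f w' I))
              (ComPreLie.shuffleProd w' Iᶜ)) ∧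
      (∀ (k : ℕ) (w' : Fin k → TensorAlgebra K V),
        ComPreLie.star B (ComPreLie.incl f 1) (ComPreLie.timesProd f w' Finset.univ) =
          ComPreLie.incl f 1 * ComPreLie.timesProd f w' Finset.univ) ∧
      (∀ (k : ℕ) (w' : Fin k → TensorAlgebra K V) (x : V) (w : TensorAlgebra K V),
        ComPreLie.star B (ComPreLie.incl f (TensorAlgebra.ι K x * w))
            (ComPreLie.timesProd f w' Finset.univ) =
          ∑ P ∈ ComPreLie.orderedPartitions 3 k,
            ComPreLie.incl f (TensorAlgebra.ι K ((f ^ (P 1).card) x) *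
              ComPreLie.shuffle (b w (ComPreLie.timesProd f w' (P 0)))
                (ComPreLie.shuffleProd w' (P 1))) *
              ComPreLie.timesProd f w' (P 2)) ∧
      (∀ (k i : ℕ) (w' : Fin k → TensorAlgebra K V) (x : Fin i → V),
        b (TensorAlgebra.tprod K V i x) (ComPreLie.timesProd f w' Finset.univ) =
          ∑ P ∈ ComPreLie.orderedPartitions i k, ComPreLie.nested f w' i x P) ∧
      (∀ (k i : ℕ) (w' : Fin k → TensorAlgebra K V) (x : Fin i → V),
        ComPreLie.star B (ComPreLie.incl f (TensorAlgebra.tprod K V i x))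
            (ComPreLie.timesProd f w' Finset.univ) =
          ∑ P ∈ ComPreLie.orderedPartitions (i + 1) k,
            ComPreLie.incl f (ComPreLie.nested f w' i x fun j => P j.castSucc) *
              ComPreLie.timesProd f w' (P (Fin.last i))) := by
  refine ⟨ComPreLie.oudomGuin K (ComPreLie.TVf f), ComPreLie.wordOrbit f,
    ComPreLie.isOudomGuinExtension_oudomGuin f, fun B' hB' => hB'.eq_oudomGuin,
    ComPreLie.incl_injective f, ComPreLie.oudomGuin_incl f, ?_⟩
  simp only [ComPreLie.star_oudomGuin]
  refine ⟨ComPreLie.starProd_assoc (K := K) (L := ComPreLie.TVf f),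
    fun X => ⟨LinearMap.congr_fun (ComPreLie.one_starProd (K := K) (L := ComPreLie.TVf f)) X,
      ComPreLie.starProd_one (K := K) (L := ComPreLie.TVf f) X⟩,
    ⟨ComPreLie.envEquivSym K (ComPreLie.TVf f),
      ComPreLie.envToSym_one (K := K) (L := ComPreLie.TVf f),
      ComPreLie.envEquivSym_mul (K := K) (L := ComPreLie.TVf f),
      ComPreLie.envToSym_ι (K := K) (L := ComPreLie.TVf f)⟩,
    fun k w' hk => ?_,
    fun k w' x w => ComPreLie.wordOrbit_cons_timesProd_univ f w' x w,
    fun k w' => ComPreLie.starProd_incl_one_timesProd f w' Finset.univ,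
    fun k w' x w => ComPreLie.starProd_cons_timesProd f w' Finset.univ x w,
    fun k i w' x => ComPreLie.wordOrbit_tprod_timesProd f w' Finset.univ i x,
    fun k i w' x => ComPreLie.starProd_tprod_timesProd f w' Finset.univ i x⟩
  have : Nonempty (Fin k) := Fin.pos_iff_nonempty.1 hk
  rw [ComPreLie.wordOrbit_one_timesProd, if_neg Finset.univ_nonempty.ne_empty]

theorem mainTheorem7 {K : Type*} [Field K] [CharZero K] {V : Type*} [AddCommGroup V] [Module K V]
    (f : V →ₗ[K] V) :
    ∃ (B : ComPreLie.STVf f →ₗ[K] ComPreLie.STVf f →ₗ[K] ComPreLie.STVf f)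
      (b : TensorAlgebra K V →ₗ[K] ComPreLie.STVf f →ₗ[K] TensorAlgebra K V),
      -- `B` is the unique Oudom-Guin extension of the pre-Lie product
      ComPreLie.IsOudomGuinExtension f B ∧
      (∀ B', ComPreLie.IsOudomGuinExtension f B' → B' = B) ∧
      -- for `u ∈ T(V, f)`, the elements `u • X` lie in `T(V, f)`; as such they are `b u X`
      Function.Injective (ComPreLie.incl f) ∧
      (∀ u X, B (ComPreLie.incl f u) X = ComPreLie.incl f (b u X)) ∧
      -- `⋆` is associative and unital, and is the product of the enveloping algebra of `T(V, f)`
      (∀ X Y Z, ComPreLie.star B (ComPreLie.star B X Y) Z =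
        ComPreLie.star B X (ComPreLie.star B Y Z)) ∧
      (∀ X, ComPreLie.star B 1 X = X ∧ ComPreLie.star B X 1 = X) ∧
      (∃ e : UniversalEnvelopingAlgebra K (ComPreLie.TVf f) ≃ₗ[K] ComPreLie.STVf f,
        e 1 = 1 ∧
        (∀ p q, e (p * q) = ComPreLie.star B (e p) (e q)) ∧
        ∀ u : ComPreLie.TVf f, e (UniversalEnvelopingAlgebra.ι K u) =
          SymmetricAlgebra.ι K (ComPreLie.TVf f) u) ∧
      -- formulas letter by letter
      (∀ (k : ℕ) (w' : Fin k → TensorAlgebra K V), 1 ≤ k →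
        b 1 (ComPreLie.timesProd f w' Finset.univ) = 0) ∧
      (∀ (k : ℕ) (w' : Fin k → TensorAlgebra K V) (x : V) (w : TensorAlgebra K V),
        b (TensorAlgebra.ι K x * w) (ComPreLie.timesProd f w' Finset.univ) =
          ∑ I : Finset (Fin k), TensorAlgebra.ι K ((f ^ (k - I.card)) x) *
            ComPreLie.shuffle (b w (ComPreLie.timesProd f w' I))
              (ComPreLie.shuffleProd w' Iᶜ)) ∧
      (∀ (k : ℕ) (w' : Fin k → TensorAlgebra K V),
        ComPreLie.star B (ComPreLie.incl f 1) (ComPreLie.timesProd f w' Finset.univ) =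
          ComPreLie.incl f 1 * ComPreLie.timesProd f w' Finset.univ) ∧
      (∀ (k : ℕ) (w' : Fin k → TensorAlgebra K V) (x : V) (w : TensorAlgebra K V),
        ComPreLie.star B (ComPreLie.incl f (TensorAlgebra.ι K x * w))
            (ComPreLie.timesProd f w' Finset.univ) =
          ∑ P ∈ ComPreLie.orderedPartitions 3 k,
            ComPreLie.incl f (TensorAlgebra.ι K ((f ^ (P 1).card) x) *
              ComPreLie.shuffle (b w (ComPreLie.timesProd f w' (P 0)))
                (ComPreLie.shuffleProd w' (P 1))) *
              ComPreLie.timesProd f w' (P 2)) ∧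
      -- closed formulas for words `x₁ … x_i`
      (∀ (k i : ℕ) (w' : Fin k → TensorAlgebra K V) (x : Fin i → V), 1 ≤ i →
        b (TensorAlgebra.tprod K V i x) (ComPreLie.timesProd f w' Finset.univ) =
          ∑ P ∈ ComPreLie.orderedPartitions i k, ComPreLie.nested f w' i x P) ∧
      (∀ (k i : ℕ) (w' : Fin k → TensorAlgebra K V) (x : Fin i → V), 1 ≤ i →
        ComPreLie.star B (ComPreLie.incl f (TensorAlgebra.tprod K V i x))
            (ComPreLie.timesProd f w' Finset.univ) =
          ∑ P ∈ ComPreLie.orderedPartitions (i + 1) k,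
            ComPreLie.incl f (ComPreLie.nested f w' i x fun j => P j.castSucc) *
              ComPreLie.timesProd f w' (P (Fin.last i))) := by
  obtain ⟨B, b, hB, hB_unique, h_inj, hb, h_assoc, h_unit, h_env, h₁, h₂, h₃, h₄, h₅, h₆⟩ :=
    mainTheorem7_general f
  exact ⟨B, b, hB, hB_unique, h_inj, hb, h_assoc, h_unit, h_env, h₁, h₂, h₃, h₄,
    fun k i w' x _ => h₅ k i w' x, fun k i w' x _ => h₆ k i w' x⟩
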